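/- Let $(W,S)$ be a finite Coxeter group with simple reflections $S=(s_i)_{i\in I}$, length function $\ell$ and longest element $w_0$. A right descent of $w\in W$ is an $i\in I$ with $\ell(ws_i)<\ell(w)$; an element is called Grassmannian if it has at most one right descent. Functions $W\to W$ act on the right, $fg$ meaning first $f$, then $g$. For $i\in I$ let $\pi_i$ and $\overline\pi_i$ be the operators on $W$ given by $w.\pi_i=w$ and $w.\overline\pi_i=ws_i$ if $i$ is a right descent of $w$, and by $w.\pi_i=ws_i$ and $w.\overline\pi_i=w$ otherwise. Put $\pi_w=\pi_{i_1}\cdots\pi_{i_k}$ and $\overline\pi_w=\overline\pi_{i_1}\cdots\overline\pi_{i_k}$ for any reduced word $i_1\cdots i_k$ of $w$. Let $M$ be the biHecke monoid, i.e. the monoid of functions $W\to W$ generated by all $\pi_i$ and $\overline\pi_i$, let $M_1=\{f\in M : 1.f=1\}$ be its Borel submonoid, and let $e_w=\pi_{w^{-1}w_0}\,\overline\pi_{w_0w}$ for $w\in W$. The $e_w$ are idempotents of $M_1$, and $M_1$ has a unique minimal (under inclusion) generating set, namely $$G=\{e_w : w\in W,\ w_0w^{-1}\text{ is Grassmannian}\}.$$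 Here a set generates $M_1$ if the elements of $M_1$ are exactly the products of one or more of its elements; thus the identity $1=e_{w_0}$, which lies in $G$, has to be a generator. (If the empty product is allowed as well, then $G\setminus\{1\}$ is the unique minimal generating set.) If $W$ is of type $A_{n-1}$ with $n\ge 1$, i.e. $W$ is the symmetric group $\mathfrak S_n$ generated by the elementary transpositions, then $|G|=2^n-n$. -/

import Mathlib

namespace BiHecke

variable {B W : Type*} [Group W] {M : CoxeterMatrix B}

/-- Functions from `W` to `W` acting on the right: in the product `f * g`, `f` is applied first. -/
abbrev RightEnd (W : Type*) : Type _ := (Function.End W)ᵐᵒᵖ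

/-- The value `w . f` of an operator acting on the right. -/
def act (w : W) (f : RightEnd W) : W := f.unop w

open Classical in
/-- The elementary bubble antisorting operator `π_i`:
`w . π_i = w` if `i` is a right descent of `w`, and `w . π_i = w s_i` otherwise. -/
noncomputable def antisort (cs : CoxeterSystem M W) (i : B) : RightEnd W :=
  MulOpposite.op (fun w : W => if cs.IsRightDescent w i then w else w * cs.simple i)

open Classical in
/-- The elementary bubble sorting operator:
`w . π̄_i = w s_i` if `i` is a right descent of `w`, and `w . π̄_i = w` otherwise. -/
noncomputable def bubbleSort (cs : CoxeterSystem M W) (i : B) : RightEnd W :=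
  MulOpposite.op (fun w : W => if cs.IsRightDescent w i then w * cs.simple i else w)

/-- The biHecke monoid, generated by all the sorting and antisorting operators. -/
noncomputable def biHeckeMonoid (cs : CoxeterSystem M W) : Submonoid (RightEnd W) :=
  Submonoid.closure (Set.range (antisort cs) ∪ Set.range (bubbleSort cs))

/-- The Borel submonoid `M₁ = {f ∈ M | 1 . f = 1}` of the biHecke monoid. -/
noncomputable def borel (cs : CoxeterSystem M W) : Submonoid (RightEnd W) where
  carrier := {f | f ∈ biHeckeMonoid cs ∧ act 1 f = 1}
  one_mem' := ⟨one_mem _, rfl⟩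
  mul_mem' := by
    rintro f g ⟨hf, hf1⟩ ⟨hg, hg1⟩
    refine ⟨mul_mem hf hg, ?_⟩
    change act (act 1 f) g = 1
    rw [hf1, hg1]

/-- A reduced word of `w`. The operators `antisortElt` and `bubbleSortElt` below do not depend on
the choice of it, because both families of operators satisfy the braid relations. -/
noncomputable def reducedWord (cs : CoxeterSystem M W) (w : W) : List B :=
  (cs.exists_isReduced w).choose

theorem reducedWord_spec (cs : CoxeterSystem M W) (w : W) :
    cs.IsReduced (reducedWord cs w) ∧ w = cs.wordProd (reducedWord cs w) :=
  (cs.exists_isReduced w).choose_spec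

/-- `π_w = π_{i_1} ⋯ π_{i_k}` for a reduced word `i_1 … i_k` of `w`. -/
noncomputable def antisortElt (cs : CoxeterSystem M W) (w : W) : RightEnd W :=
  ((reducedWord cs w).map (antisort cs)).prod

/-- `π̄_w = π̄_{i_1} ⋯ π̄_{i_k}` for a reduced word `i_1 … i_k` of `w`. -/
noncomputable def bubbleSortElt (cs : CoxeterSystem M W) (w : W) : RightEnd W :=
  ((reducedWord cs w).map (bubbleSort cs)).prod

/-- The longest element `w_0` of a finite Coxeter group: its (unique) element of maximal length. -/
noncomputable def longest [Finite W] (cs : CoxeterSystem M W) : W :=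
  (Finite.exists_max cs.length).choose

theorem length_le_longest [Finite W] (cs : CoxeterSystem M W) (w : W) :
    cs.length w ≤ cs.length (longest cs) :=
  (Finite.exists_max cs.length).choose_spec w

/-- The element `e_w = π_{w⁻¹ w_0} π̄_{w_0 w}`. -/
noncomputable def e [Finite W] (cs : CoxeterSystem M W) (w : W) : RightEnd W :=
  antisortElt cs (w⁻¹ * longest cs) * bubbleSortElt cs (longest cs * w)

/-- An element of a Coxeter group is Grassmannian if it has at most one right descent. -/
def IsGrassmannian (cs : CoxeterSystem M W) (w : W) : Prop :=
  {i : B | cs.IsRightDescent w i}.Subsingleton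

/-- The set of the `e_w` for which `w_0 w⁻¹` is Grassmannian. -/
def grassmannianIdempotents [Finite W] (cs : CoxeterSystem M W) : Set (RightEnd W) :=
  {f | ∃ w : W, IsGrassmannian cs (longest cs * w⁻¹) ∧ f = e cs w}

/-- `X` generates the monoid `N` in the sense of products of one or more factors: the elements of
`N` are exactly the nonempty finite products of elements of `X`. -/
def Generates {A : Type*} [Monoid A] (N : Submonoid A) (X : Set A) : Prop :=
  Subsemigroup.closure X = N.toSubsemigroup

/-- `X` generates the monoid `N` in the sense where the empty product `1` is allowed as well. -/
def GeneratesAsMonoid {A : Type*} [Monoid A] (N : Submonoid A) (X : Set A) : Prop :=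
  Submonoid.closure X = N

end BiHecke

/-! Write `w.f` for the right action, `π_v`, `π̄_v` for antisorting and sorting along `v`, and `≤`
for the left weak order. An operator of the biHecke monoid sends an edge `w – s_j w` of this order
to an edge with the same label or collapses it (`act_simple_mul`). Hence it preserves `≤` and does
not stretch intervals. Elements of the Borel submonoid therefore never increase length and fix
whatever keeps its length, their fixed points form a lower set, and a product fixes `w` only if both
factors do.

The idempotent `e_w` fixes exactly the interval `[1, w]` and has its image in it, and `e_w = π_v
π̄_{v⁻¹}` for `v = w⁻¹ w_0` (`sortIdempotent`). Generation rests on `π_v π̄_i = sortIdempotent (v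
s_i) π_v` for a non-descent `i` of `v`. Pushing `π_v` through a word writes every `f` of the biHecke
monoid as a product of `e`'s times `π_{1.f}`, and the last factor is trivial if `1.f = 1`
(`closure_range_e`). If `v` has two descents, the same relation factors `sortIdempotent v` into
idempotents of shorter elements (`sortIdempotent_mem_closure_of_descents`), so only Grassmannian `v`
are needed.

For minimality, let `w ≠ w_0` have a single left non-descent `s`. A Borel element that fixes `w`
either fixes `s w` or equals `e_w` (`act_simple_mul_eq_or_eq_e`). As `e_w` does not fix `s w`, any
product equal to `e_w` has `e_w` among its factors.

In type `A`, Grassmannian elements other than the identity correspond to non-monotone binary words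
through `Tuple.sort`. -/

namespace BiHecke

open CoxeterSystem Polynomial.Chebyshev

/-! ### Coxeter groups: the reflection cocycle, the lifting property, distinctness of simple
reflections. -/

section Coxeter

variable {B W : Type*} [Group W] {M : CoxeterMatrix B} (cs : CoxeterSystem M W)

open Classical in
/-- The action of a simple reflection on pairs of a group element and a sign. -/
noncomputable def signStep (i : B) : Function.End (W × ZMod 2) := fun p =>
  (cs.simple i * p.1 * cs.simple i, p.2 + if p.1 = cs.simple i then 1 else 0)

open Classical in
theorem signStep_mul_pow (i j : B) (m : ℕ) (t : W) (c : ZMod 2) :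
    ((signStep cs i * signStep cs j) ^ m) (t, c) =
      ((cs.simple i * cs.simple j) ^ m * t * (cs.simple j * cs.simple i) ^ m,
        c + ∑ k ∈ Finset.range (2 * m),
          if t = (cs.simple j * cs.simple i) ^ k * cs.simple j then 1 else 0) := by
  induction m with
  | zero =>
    rw [pow_zero]
    change (t, c) = _
    simp
  | succ m ih =>
    rw [pow_succ']
    change signStep cs i (signStep cs j (((signStep cs i * signStep cs j) ^ m) (t, c))) = _
    rw [ih]
    set r := cs.simple j * cs.simple i with hr
    have hinv : cs.simple i * cs.simple j = r⁻¹ := by simp [hr]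
    have hconj : ∀ k : ℕ, cs.simple j * (r⁻¹) ^ k = r ^ k * cs.simple j := by
      intro k
      induction k with
      | zero => simp
      | succ k ihk =>
        rw [pow_succ, ← mul_assoc, ihk, pow_succ, ← hinv, hr]
        simp [mul_assoc]
    have key : ∀ (x : W), ((r⁻¹) ^ m * t * r ^ m = x ↔ t = r ^ m * x * (r⁻¹) ^ m) := by
      intro x
      rw [inv_pow]
      constructor
      · rintro rfl; group
      · rintro rfl; group
    simp only [signStep, hinv, Prod.mk.injEq]
    refine ⟨?_, ?_⟩
    · rw [pow_succ' r⁻¹, pow_succ r]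
      have h1 : cs.simple i * (cs.simple j * (r⁻¹ ^ m * t * r ^ m) * cs.simple j) * cs.simple i
        = (cs.simple i * cs.simple j) * (r⁻¹ ^ m * t * r ^ m) * (cs.simple j * cs.simple i) := by
        group
      rw [h1, hinv, ← hr]
      simp only [inv_pow]
      group
    · rw [show 2 * (m + 1) = 2 * m + 1 + 1 by ring, Finset.sum_range_succ, Finset.sum_range_succ]
      have e1 : (r⁻¹ ^ m * t * r ^ m = cs.simple j) ↔ t = r ^ (2 * m) * cs.simple j := by
        rw [key, mul_assoc, hconj, two_mul, pow_add, mul_assoc]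
      have e2 : (cs.simple j * (r⁻¹ ^ m * t * r ^ m) * cs.simple j = cs.simple i) ↔
          t = r ^ (2 * m + 1) * cs.simple j := by
        have : (cs.simple j * (r⁻¹ ^ m * t * r ^ m) * cs.simple j = cs.simple i) ↔
            (r⁻¹ ^ m * t * r ^ m) = r * cs.simple j := by
          rw [hr]
          constructor
          · intro h
            generalize (cs.simple j * cs.simple i)⁻¹ ^ m * t * (cs.simple j * cs.simple i) ^ m = y
              at h ⊢
            rw [← h]; simp [mul_assoc]
          · intro h; rw [h]; simp [mul_assoc]
        rw [this, key, mul_assoc, mul_assoc, hconj, show 2 * m + 1 = m + 1 + m by ring, pow_add,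
          pow_add, pow_one]
        simp only [mul_assoc]
      simp only [e1, e2]
      ring

theorem signStep_isLiftable : M.IsLiftable (signStep cs) := by
  classical
  intro i j
  funext ⟨t, c⟩
  rw [signStep_mul_pow]
  have h : (cs.simple j * cs.simple i) ^ M i j = 1 := cs.simple_mul_simple_pow' i j
  -- The summands at `k` and at `k + M i j` coincide, so the sum vanishes modulo 2.
  rw [cs.simple_mul_simple_pow, h, two_mul, Finset.sum_range_add]
  simp only [pow_add, h, one_mul, mul_one]
  rw [CharTwo.add_self_eq_zero, add_zero]
  rfl

/-- The action of a Coxeter group on pairs of a group element and a sign. -/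
noncomputable def signAction (w : W) (p : W × ZMod 2) : W × ZMod 2 :=
  cs.lift ⟨signStep cs, signStep_isLiftable cs⟩ w p

theorem signAction_one (p : W × ZMod 2) : signAction cs 1 p = p := by
  unfold signAction
  rw [map_one]
  rfl

theorem signAction_mul (v w : W) (p : W × ZMod 2) :
    signAction cs (v * w) p = signAction cs v (signAction cs w p) := by
  unfold signAction
  rw [map_mul]
  rfl

theorem signAction_simple (i : B) (p : W × ZMod 2) :
    signAction cs (cs.simple i) p = signStep cs i p := by
  unfold signAction
  rw [cs.lift_apply_simple]

/-- The reflection cocycle: `inversionParity w t` is the parity of the number of occurrences of `t`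
among the right inversions of a word of `w`. -/
noncomputable def inversionParity (w t : W) : ZMod 2 := (signAction cs w (t, 0)).2

open Classical in
theorem signAction_apply_fst (w : W) (p : W × ZMod 2) :
    (signAction cs w p).1 = w * p.1 * w⁻¹ := by
  induction w using cs.simple_induction_left with
  | one => simp [signAction_one]
  | mul_simple_left w i ih =>
    rw [signAction_mul, signAction_simple, signStep, ih]
    simp [mul_assoc]

open Classical in
theorem signAction_apply (w t : W) (c : ZMod 2) :
    signAction cs w (t, c) = (w * t * w⁻¹, c + inversionParity cs w t) := by
  unfold inversionParity
  refine Prod.ext (signAction_apply_fst cs w _) ?_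
  induction w using cs.simple_induction_left with
  | one => simp [signAction_one]
  | mul_simple_left w i ih =>
    simp only [signAction_mul, signAction_simple, signStep, ih, signAction_apply_fst]
    ring

open Classical in
theorem inversionParity_simple_mul (w t : W) (j : B) :
    inversionParity cs (cs.simple j * w) t =
      inversionParity cs w t + if w * t * w⁻¹ = cs.simple j then 1 else 0 := by
  rw [inversionParity, signAction_mul, signAction_simple, signAction_apply]
  simp [signStep]

theorem inversionParity_mul_simple (w : W) (i : B) :
    inversionParity cs (w * cs.simple i) (cs.simple i) =
      1 + inversionParity cs w (cs.simple i) := by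
  rw [inversionParity, signAction_mul, signAction_simple]
  simp [signStep, signAction_apply]

theorem inversionParity_wordProd_eq_zero (ω : List B) {t : W} (h : t ∉ cs.rightInvSeq ω) :
    inversionParity cs (cs.wordProd ω) t = 0 := by
  classical
  induction ω with
  | nil => simp [inversionParity, signAction_one]
  | cons i ω ih =>
    rw [rightInvSeq, List.mem_cons, not_or] at h
    rw [cs.wordProd_cons, inversionParity_simple_mul, ih h.2, if_neg, add_zero]
    intro h'
    apply h.1
    rw [← h']
    group

/-- Nonzero parity puts `s_i` among the right inversions of a reduced word, hence forces a descent.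
The converse follows because `w` and `w s_i` have opposite parities, while only one of them has the
descent `i`. -/
theorem isRightDescent_iff_inversionParity (w : W) (i : B) :
    cs.IsRightDescent w i ↔ inversionParity cs w (cs.simple i) = 1 := by
  have key : ∀ w : W, inversionParity cs w (cs.simple i) ≠ 0 → cs.IsRightDescent w i := by
    intro w h
    obtain ⟨ω, hω, rfl⟩ := cs.exists_isReduced w
    rw [← cs.isRightInversion_simple_iff_isRightDescent]
    apply cs.isRightInversion_of_mem_rightInvSeq hω
    by_contra h'
    exact h (inversionParity_wordProd_eq_zero cs ω h')
  have h01 : ∀ c : ZMod 2, c ≠ 1 → c = 0 := by decide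
  constructor
  · intro h
    by_contra h1
    have h0 := h01 _ h1
    have := key (w * cs.simple i) (by rw [inversionParity_mul_simple, h0]; decide)
    exact (cs.isRightDescent_iff_not_isRightDescent_mul.mp h) this
  · intro h
    exact key w (by rw [h]; decide)

/-- The lifting property. -/
theorem simple_mul_eq_mul_simple {w : W} {i j : B} (h : ¬ cs.IsRightDescent w i)
    (h' : cs.IsRightDescent (cs.simple j * w) i) : cs.simple j * w = w * cs.simple i := by
  classical
  rw [isRightDescent_iff_inversionParity] at h h'
  rw [inversionParity_simple_mul] at h'
  -- Left multiplication by `s_j` changes the cocycle at `s_i` only if `w s_i w⁻¹ = s_j`.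
  by_cases hw : w * cs.simple i * w⁻¹ = cs.simple j
  · rw [← hw]; group
  · rw [if_neg hw, add_zero] at h'
    exact absurd h' h

/-- The coefficients of the geometric representation. -/
noncomputable def cartanEntry (M : CoxeterMatrix B) (i j : B) : ℝ :=
  -2 * Real.cos (Real.pi / M i j)

theorem cartanEntry_self (i : B) : cartanEntry M i i = 2 := by simp [cartanEntry]

/-- The coroots of the geometric representation. -/
noncomputable def coroot (M : CoxeterMatrix B) (i : B) : Module.Dual ℝ (B →₀ ℝ) :=
  Finsupp.linearCombination ℝ (cartanEntry M i)

theorem coroot_single (i j : B) :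
    coroot M i (Finsupp.single j 1) = cartanEntry M i j := by
  simp [coroot]

theorem coroot_single_self (i : B) : coroot M i (Finsupp.single i 1) = 2 := by
  rw [coroot_single, cartanEntry_self]

theorem cartanEntry_mul_sub (i j : B) :
    cartanEntry M i j * cartanEntry M j i - 2 = 2 * Real.cos (2 * Real.pi / M i j) := by
  rw [cartanEntry, cartanEntry, M.symmetric j i, mul_div_assoc, Real.cos_two_mul]
  ring

/-- Powers of a product of two reflections are given by the Chebyshev polynomials `S` at `2 cos θ`,
`θ = 2π/m`. Multiplied by `sin θ` these become sines of multiples of `θ`, and the required ones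
vanish or cancel because `m θ = 2π`. -/
theorem reflection_isLiftable :
    M.IsLiftable (fun i => Module.reflection (coroot_single_self (M := M) i)) := by
  intro i j
  rcases eq_or_ne i j with rfl | hij
  · rw [M.diagonal, pow_one]
    exact mul_eq_one_iff_eq_inv.mpr (Module.reflection_inv _).symm
  ext1 z
  rw [Module.reflection_mul_reflection_pow_apply _ _ (M i j) z
    (2 * Real.cos (2 * Real.pi / M i j))
    (by rw [coroot_single, coroot_single, cartanEntry_mul_sub])]
  set m := M i j with hm
  have hm1 : m ≠ 1 := M.off_diagonal i j hij
  rcases Nat.eq_zero_or_pos m with h0 | hpos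
  · simp [h0]
  -- Here `θ` would be `π`, with sine zero, so the division by `sin θ` used below is not available.
  rcases eq_or_ne m 2 with h2 | h2
  · have hc : cartanEntry M i j = 0 := by rw [cartanEntry, ← hm, h2]; simp
    have hc' : cartanEntry M j i = 0 := by rw [cartanEntry, M.symmetric, ← hm, h2]; simp
    rw [h2, coroot_single, coroot_single, hc, hc']
    norm_num
    abel
  have hm3 : 3 ≤ m := by omega
  have hmR : (3 : ℝ) ≤ m := by exact_mod_cast hm3
  set θ := 2 * Real.pi / (m : ℝ) with hθ
  have hmθ : m * θ = 2 * Real.pi := by rw [hθ]; field_simp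
  have hsin : Real.sin θ ≠ 0 := by
    apply ne_of_gt
    apply Real.sin_pos_of_pos_of_lt_pi
    · positivity
    · rw [hθ, div_lt_iff₀ (by positivity)]
      nlinarith [Real.pi_pos]
  rcases Nat.even_or_odd' m with ⟨k, hk | hk⟩
  · have e1 : ((m : ℤ) - 2) / 2 = k - 1 := by omega
    have e2 : ((m : ℤ) - 1) / 2 = k - 1 := by omega
    have hS : (S ℝ ((k : ℤ) - 1)).eval (2 * Real.cos θ) = 0 := by
      apply (mul_eq_zero.mp _).resolve_right hsin
      rw [S_two_mul_real_cos]
      have : ((((k : ℤ) - 1 : ℤ) : ℝ) + 1) * θ = Real.pi := by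
        push_cast
        have : (m : ℝ) = 2 * k := by exact_mod_cast hk
        rw [this] at hmθ
        linarith
      rw [this, Real.sin_pi]
    rw [e1, e2, hS]
    simp
  · have e1 : ((m : ℤ) - 2) / 2 = k - 1 := by omega
    have e2 : ((m : ℤ) - 1) / 2 = k := by omega
    have e3 : ((m : ℤ) - 3) / 2 = k - 1 := by omega
    have e4 : (m : ℤ) / 2 = k := by omega
    have hS : (S ℝ (k : ℤ)).eval (2 * Real.cos θ) +
        (S ℝ ((k : ℤ) - 1)).eval (2 * Real.cos θ) = 0 := by
      apply (mul_eq_zero.mp _).resolve_right hsin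
      rw [add_mul, S_two_mul_real_cos, S_two_mul_real_cos]
      have : (((k : ℤ) : ℝ) + 1) * θ = 2 * Real.pi - ((((k : ℤ) - 1 : ℤ) : ℝ) + 1) * θ := by
        push_cast
        have : (m : ℝ) = 2 * k + 1 := by exact_mod_cast hk
        rw [this] at hmθ
        linarith
      rw [this, Real.sin_two_pi_sub]
      ring
    rw [e1, e2, e3, e4, hS]
    simp

/-- The simple reflections of a Coxeter system are distinct. -/
theorem simple_injective : Function.Injective cs.simple := by
  intro i j h
  by_contra hij
  have h1 := congrArg (cs.lift ⟨_, reflection_isLiftable (M := M)⟩) h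
  rw [cs.lift_apply_simple, cs.lift_apply_simple] at h1
  -- The coefficient of the `i`-th simple root in its own image is `-1` under the `i`-th reflection
  -- and `1` under the `j`-th.
  have h2 := congrArg (fun f => (f (Finsupp.single i 1)) i) h1
  simp only [Module.reflection_apply, coroot_single_self] at h2
  simp [Ne.symm hij] at h2

end Coxeter

section Act

variable {W : Type*}

theorem act_mul (w : W) (f g : RightEnd W) : act w (f * g) = act (act w f) g := rfl

theorem act_one (w : W) : act w (1 : RightEnd W) = w := rfl

theorem rightEnd_ext {f g : RightEnd W} (h : ∀ w, act w f = act w g) : f = g :=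
  MulOpposite.unop_injective (funext h)

end Act

/-! ### The 0-Hecke monoid of antisorting operators. -/

section Operators

variable {B W : Type*} [Group W] {M : CoxeterMatrix B} (cs : CoxeterSystem M W)

variable {cs} in
theorem act_antisort_of_descent {w : W} {i : B} (h : cs.IsRightDescent w i) :
    act w (antisort cs i) = w := if_pos h

variable {cs} in
theorem act_antisort_of_not_descent {w : W} {i : B} (h : ¬ cs.IsRightDescent w i) :
    act w (antisort cs i) = w * cs.simple i := if_neg h

variable {cs} in
theorem act_bubbleSort_of_descent {w : W} {i : B} (h : cs.IsRightDescent w i) :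
    act w (bubbleSort cs i) = w * cs.simple i := if_pos h

variable {cs} in
theorem act_bubbleSort_of_not_descent {w : W} {i : B} (h : ¬ cs.IsRightDescent w i) :
    act w (bubbleSort cs i) = w := if_neg h

theorem antisort_mul_antisort (i : B) : antisort cs i * antisort cs i = antisort cs i := by
  refine rightEnd_ext fun w => ?_
  rw [act_mul]
  by_cases h : cs.IsRightDescent w i
  · rw [act_antisort_of_descent h, act_antisort_of_descent h]
  · rw [act_antisort_of_not_descent h, act_antisort_of_descent]
    rwa [cs.isRightDescent_iff_not_isRightDescent_mul, cs.simple_mul_simple_cancel_right]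

theorem antisort_mul_bubbleSort (i : B) : antisort cs i * bubbleSort cs i = bubbleSort cs i := by
  refine rightEnd_ext fun w => ?_
  rw [act_mul]
  by_cases h : cs.IsRightDescent w i
  · rw [act_antisort_of_descent h]
  · rw [act_antisort_of_not_descent h, act_bubbleSort_of_not_descent h, act_bubbleSort_of_descent,
      cs.simple_mul_simple_cancel_right]
    rwa [cs.isRightDescent_iff_not_isRightDescent_mul, cs.simple_mul_simple_cancel_right]

/-- The left antisorting operator. -/
noncomputable def leftAntisort (j : B) (w : W) : W := (act w⁻¹ (antisort cs j))⁻¹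

variable {cs} in
theorem leftAntisort_of_descent {w : W} {j : B} (h : cs.IsLeftDescent w j) :
    leftAntisort cs j w = w := by
  rw [leftAntisort, act_antisort_of_descent (by rwa [cs.isRightDescent_inv_iff]), inv_inv]

variable {cs} in
theorem leftAntisort_of_not_descent {w : W} {j : B} (h : ¬ cs.IsLeftDescent w j) :
    leftAntisort cs j w = cs.simple j * w := by
  rw [leftAntisort, act_antisort_of_not_descent (by rwa [cs.isRightDescent_inv_iff])]
  simp

variable {cs} in
theorem isRightDescent_simple_mul {w : W} {i j : B} (h : cs.IsRightDescent w i)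
    (h' : ¬ cs.IsLeftDescent w j) : cs.IsRightDescent (cs.simple j * w) i := by
  rw [cs.not_isLeftDescent_iff] at h'
  rw [cs.isRightDescent_iff] at h
  have := cs.length_simple_mul (w * cs.simple i) j
  rw [← mul_assoc] at this
  unfold IsRightDescent
  omega

variable {cs} in
theorem not_isLeftDescent_mul_simple {w : W} {i j : B} (h : cs.IsRightDescent w i)
    (h' : ¬ cs.IsLeftDescent w j) : ¬ cs.IsLeftDescent (w * cs.simple i) j := by
  have h2 := isRightDescent_simple_mul h h'
  rw [cs.not_isLeftDescent_iff] at h' ⊢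
  rw [cs.isRightDescent_iff] at h h2
  rw [← mul_assoc]
  omega

/-- The left and right 0-Hecke actions commute. The one delicate case is that `i` becomes a descent
only after multiplying by `s_j`; then the lifting property identifies both steps as the same edge.
-/
theorem leftAntisort_act_antisort_of_not_descent {w : W} {i j : B}
    (hj : ¬ cs.IsLeftDescent w j) :
    leftAntisort cs j (act w (antisort cs i)) = act (leftAntisort cs j w) (antisort cs i) := by
  rw [leftAntisort_of_not_descent hj]
  by_cases hi : cs.IsRightDescent w i
  · rw [act_antisort_of_descent hi, leftAntisort_of_not_descent hj,
      act_antisort_of_descent (isRightDescent_simple_mul hi hj)]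
  · rw [act_antisort_of_not_descent hi]
    by_cases hij : cs.IsRightDescent (cs.simple j * w) i
    · have h := simple_mul_eq_mul_simple cs hi hij
      rw [act_antisort_of_descent hij, ← h, leftAntisort_of_descent]
      rwa [cs.isLeftDescent_iff_not_isLeftDescent_mul, cs.simple_mul_simple_cancel_left]
    · rw [act_antisort_of_not_descent hij, leftAntisort_of_not_descent, mul_assoc]
      rw [cs.not_isLeftDescent_iff] at hj ⊢
      rw [cs.not_isRightDescent_iff] at hi hij
      rw [← mul_assoc]
      omega

theorem leftAntisort_leftAntisort (j : B) (w : W) :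
    leftAntisort cs j (leftAntisort cs j w) = leftAntisort cs j w := by
  simp only [leftAntisort, inv_inv]
  rw [← act_mul, antisort_mul_antisort]

theorem leftAntisort_act_antisort (w : W) (i j : B) :
    leftAntisort cs j (act w (antisort cs i)) = act (leftAntisort cs j w) (antisort cs i) := by
  by_cases hj : cs.IsLeftDescent w j
  · have hj' := cs.isLeftDescent_iff_not_isLeftDescent_mul.mp hj
    have h := leftAntisort_act_antisort_of_not_descent cs (i := i) hj'
    rw [leftAntisort_of_not_descent hj', cs.simple_mul_simple_cancel_left] at h
    rw [← h, leftAntisort_leftAntisort, leftAntisort_of_descent hj, h]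
  · exact leftAntisort_act_antisort_of_not_descent cs hj

/-- The product of the antisorting operators along a word. -/
noncomputable def antisortWord (ω : List B) : RightEnd W := (ω.map (antisort cs)).prod

theorem antisortWord_nil : antisortWord cs [] = 1 := rfl

theorem antisortWord_cons (i : B) (ω : List B) :
    antisortWord cs (i :: ω) = antisort cs i * antisortWord cs ω := by simp [antisortWord]

theorem antisortWord_append (ω ω' : List B) :
    antisortWord cs (ω ++ ω') = antisortWord cs ω * antisortWord cs ω' := by simp [antisortWord]

theorem leftAntisort_act_antisortWord (w : W) (j : B) (ω : List B) :
    leftAntisort cs j (act w (antisortWord cs ω)) =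
      act (leftAntisort cs j w) (antisortWord cs ω) := by
  induction ω generalizing w with
  | nil => rfl
  | cons i ω ih => rw [antisortWord_cons, act_mul, act_mul, ih, leftAntisort_act_antisort]

/-- On the identity, the left and right operators of a letter agree. The first letter of the word
can thus be moved to the other side and, as the two actions commute, applied last. -/
theorem inv_act_one_antisortWord (ω : List B) :
    (act 1 (antisortWord cs ω))⁻¹ = act 1 (antisortWord cs ω.reverse) := by
  induction ω with
  | nil => simp [antisortWord_nil, act_one]
  | cons i ω ih =>
    have h : act 1 (antisort cs i) = leftAntisort cs i 1 := by
      rw [leftAntisort_of_not_descent (cs.not_isLeftDescent_one i),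
        act_antisort_of_not_descent (cs.not_isRightDescent_one i), one_mul, mul_one]
    rw [antisortWord_cons, act_mul, h, ← leftAntisort_act_antisortWord, List.reverse_cons,
      antisortWord_append, act_mul, ← ih, antisortWord_cons, antisortWord_nil, mul_one,
      leftAntisort, inv_inv]

theorem act_antisortWord_of_length {x : W} {ω : List B}
    (h : cs.length (x * cs.wordProd ω) = cs.length x + ω.length) :
    act x (antisortWord cs ω) = x * cs.wordProd ω := by
  induction ω generalizing x with
  | nil => simp [antisortWord_nil, act_one]
  | cons i ω ih =>
    rw [cs.wordProd_cons, ← mul_assoc, List.length_cons] at h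
    have h1 := cs.length_mul_le (x * cs.simple i) (cs.wordProd ω)
    have h2 := cs.length_wordProd_le ω
    have h3 : ¬ cs.IsRightDescent x i := by unfold IsRightDescent; omega
    have h4 := cs.not_isRightDescent_iff.mp h3
    rw [antisortWord_cons, act_mul, act_antisort_of_not_descent h3, ih (by omega),
      cs.wordProd_cons, mul_assoc]

variable {cs} in
theorem act_one_antisortWord_of_isReduced {ω : List B} (h : cs.IsReduced ω) :
    act 1 (antisortWord cs ω) = cs.wordProd ω := by
  rw [act_antisortWord_of_length, one_mul]
  rw [one_mul, h.eq, cs.length_one, zero_add]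

/-- A product of antisorting operators is determined by the image of the identity. -/
theorem antisortWord_eq_of_act_one {ω ω' : List B}
    (h : act 1 (antisortWord cs ω) = act 1 (antisortWord cs ω')) :
    antisortWord cs ω = antisortWord cs ω' := by
  refine rightEnd_ext fun x => ?_
  suffices ∀ ν : List B, act (act 1 (antisortWord cs ν)) (antisortWord cs ω) =
      act (act 1 (antisortWord cs ν)) (antisortWord cs ω') by
    obtain ⟨ν, hν, rfl⟩ := cs.exists_isReduced x
    rw [← act_one_antisortWord_of_isReduced hν]
    exact this ν
  -- The inverse of `1.(νω)` is `1` acted on by the reversed `ω` and then the reversed `ν`, so it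
  -- depends on `ω` only through `(1.ω)⁻¹`.
  intro ν
  rw [← inv_inj, ← act_mul, ← act_mul, ← antisortWord_append, ← antisortWord_append,
    inv_act_one_antisortWord, inv_act_one_antisortWord, List.reverse_append, List.reverse_append,
    antisortWord_append, antisortWord_append, act_mul, act_mul, ← inv_act_one_antisortWord, h,
    inv_act_one_antisortWord]

theorem antisortElt_eq_antisortWord {ω : List B} (h : cs.IsReduced ω) :
    antisortElt cs (cs.wordProd ω) = antisortWord cs ω := by
  obtain ⟨h1, h2⟩ := reducedWord_spec cs (cs.wordProd ω)
  apply antisortWord_eq_of_act_one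
  rw [act_one_antisortWord_of_isReduced h1, act_one_antisortWord_of_isReduced h, ← h2]

theorem act_antisortElt {x y : W} (h : cs.length (x * y) = cs.length x + cs.length y) :
    act x (antisortElt cs y) = x * y := by
  obtain ⟨ω, h1, rfl⟩ := cs.exists_isReduced y
  rw [antisortElt_eq_antisortWord cs h1, act_antisortWord_of_length]
  rw [h, h1.eq]

theorem antisortElt_mul {x y : W} (h : cs.length (x * y) = cs.length x + cs.length y) :
    antisortElt cs (x * y) = antisortElt cs x * antisortElt cs y := by
  obtain ⟨ω, h1, rfl⟩ := cs.exists_isReduced x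
  obtain ⟨ν, h2, rfl⟩ := cs.exists_isReduced y
  rw [antisortElt_eq_antisortWord cs h1, antisortElt_eq_antisortWord cs h2, ← antisortWord_append,
    ← antisortElt_eq_antisortWord, cs.wordProd_append]
  rw [CoxeterSystem.IsReduced, cs.wordProd_append, h, h1.eq, h2.eq, List.length_append]

theorem antisortElt_simple (i : B) : antisortElt cs (cs.simple i) = antisort cs i := by
  rw [← cs.wordProd_singleton, antisortElt_eq_antisortWord, antisortWord_cons, antisortWord_nil,
    mul_one]
  simp [CoxeterSystem.IsReduced]

theorem antisortElt_one : antisortElt cs 1 = 1 := by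
  rw [← cs.wordProd_nil, antisortElt_eq_antisortWord, antisortWord_nil]
  simp [CoxeterSystem.IsReduced]

theorem inv_act_antisortElt (x y : W) :
    (act x (antisortElt cs y))⁻¹ = act y⁻¹ (antisortElt cs x⁻¹) := by
  obtain ⟨ω, h1, rfl⟩ := cs.exists_isReduced x
  obtain ⟨ν, h2, rfl⟩ := cs.exists_isReduced y
  rw [← cs.wordProd_reverse, ← cs.wordProd_reverse, antisortElt_eq_antisortWord cs h2,
    antisortElt_eq_antisortWord cs h1.reverse, ← act_one_antisortWord_of_isReduced h1,
    ← act_one_antisortWord_of_isReduced h2.reverse, ← act_mul, ← act_mul, ← antisortWord_append,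
    ← antisortWord_append, inv_act_one_antisortWord, List.reverse_append]

theorem exists_act_antisortWord (x : W) (ω : List B) :
    ∃ y, act x (antisortWord cs ω) = x * y ∧ cs.length (x * y) = cs.length x + cs.length y := by
  induction ω using List.reverseRecOn with
  | nil => exact ⟨1, by simp [antisortWord_nil, act_one], by simp⟩
  | append_singleton ω i ih =>
    obtain ⟨y, h1, h2⟩ := ih
    rw [antisortWord_append, act_mul, h1, antisortWord_cons, antisortWord_nil, mul_one]
    by_cases h : cs.IsRightDescent (x * y) i
    · exact ⟨y, act_antisort_of_descent h, h2⟩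
    · refine ⟨y * cs.simple i, by rw [act_antisort_of_not_descent h, mul_assoc], ?_⟩
      rw [cs.not_isRightDescent_iff, mul_assoc] at h
      have h3 := cs.length_mul_le x (y * cs.simple i)
      have h4 := cs.length_mul_simple y i
      omega

theorem antisort_mul_antisortElt {i : B} {w : W} (h : cs.IsLeftDescent w i) :
    antisort cs i * antisortElt cs w = antisortElt cs w := by
  obtain ⟨v, rfl⟩ : ∃ v, w = cs.simple i * v := ⟨cs.simple i * w, by simp⟩
  rw [cs.isLeftDescent_iff, cs.simple_mul_simple_cancel_left] at h
  rw [antisortElt_mul cs (by rw [cs.length_simple]; omega), antisortElt_simple, ← mul_assoc,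
    antisort_mul_antisort]

theorem isRightDescent_of_maximal {w : W} (h : ∀ x, cs.length x ≤ cs.length w) (i : B) :
    cs.IsRightDescent w i := by
  have h1 := cs.length_mul_simple w i
  have h2 := h (w * cs.simple i)
  unfold IsRightDescent
  omega

theorem act_antisortWord_of_maximal {w : W} (h : ∀ x, cs.length x ≤ cs.length w) (ω : List B) :
    act w (antisortWord cs ω) = w := by
  induction ω with
  | nil => rfl
  | cons i ω ih =>
    rw [antisortWord_cons, act_mul, act_antisort_of_descent (isRightDescent_of_maximal cs h i), ih]

theorem act_one_antisortElt (v : W) : act 1 (antisortElt cs v) = v := by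
  rw [act_antisortElt, one_mul]
  simp

theorem antisortElt_mul_simple {w : W} {i : B} (h : ¬ cs.IsRightDescent w i) :
    antisortElt cs (w * cs.simple i) = antisortElt cs w * antisort cs i := by
  rw [antisortElt_mul, antisortElt_simple]
  rw [cs.length_simple, cs.not_isRightDescent_iff.mp h]

theorem antisortElt_mul_antisort {v : W} {i : B} (h : cs.IsRightDescent v i) :
    antisortElt cs v * antisort cs i = antisortElt cs v := by
  obtain ⟨u, rfl⟩ : ∃ u, v = u * cs.simple i := ⟨v * cs.simple i, by simp⟩
  rw [cs.isRightDescent_iff_not_isRightDescent_mul, cs.simple_mul_simple_cancel_right] at h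
  rw [antisortElt_mul_simple cs h, mul_assoc, antisort_mul_antisort]

theorem act_antisortWord_of_descents {w : W} {ω : List B}
    (h : ∀ i ∈ ω, cs.IsRightDescent w i) : act w (antisortWord cs ω) = w := by
  induction ω with
  | nil => rfl
  | cons i ω ih =>
    rw [antisortWord_cons, act_mul, act_antisort_of_descent (h i (by simp)),
      ih fun i hi => h i (by simp [hi])]

/-! ### The longest element and the exchange of sorting with antisorting. -/

section Longest

variable [Finite W]

/-- Acting on `x` by `π_{w_0}` gives `w_0`: after inversion this is the action of a word on `w_0⁻¹`,
which also has maximal length and so cannot move. Antisorting multiplies by a factor that adds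
lengths. That `w_0` is an involution is not yet known here. -/
theorem length_add_length_inv_mul_longest (x : W) :
    cs.length x + cs.length (x⁻¹ * longest cs) = cs.length (longest cs) := by
  have h : ∀ x, cs.length x ≤ cs.length (longest cs)⁻¹ := by
    intro x
    rw [cs.length_inv]
    exact length_le_longest cs x
  obtain ⟨y, h1, h2⟩ := exists_act_antisortWord cs x (reducedWord cs (longest cs))
  have h3 : act x (antisortElt cs (longest cs)) = longest cs := by
    rw [← inv_inj, inv_act_antisortElt]
    exact act_antisortWord_of_maximal cs h _
  have h4 : longest cs = x * y := h3.symm.trans h1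
  rw [h4, h2, inv_mul_cancel_left]

theorem longest_mul_longest : longest cs * longest cs = 1 := by
  have := length_add_length_inv_mul_longest cs (longest cs)⁻¹
  rw [cs.length_inv, inv_inv] at this
  exact cs.length_eq_zero_iff.mp (by omega)

theorem longest_inv : (longest cs)⁻¹ = longest cs :=
  inv_eq_of_mul_eq_one_left (longest_mul_longest cs)

theorem longest_mul_longest_mul (w : W) : longest cs * (longest cs * w) = w := by
  rw [← mul_assoc, longest_mul_longest, one_mul]

theorem length_add_length_longest_mul (x : W) :
    cs.length x + cs.length (longest cs * x) = cs.length (longest cs) := by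
  have := length_add_length_inv_mul_longest cs x
  rwa [← cs.length_inv (x⁻¹ * _), mul_inv_rev, inv_inv, longest_inv] at this

theorem isRightDescent_longest_mul {w : W} {i : B} :
    cs.IsRightDescent (longest cs * w) i ↔ ¬ cs.IsRightDescent w i := by
  rw [cs.not_isRightDescent_iff, cs.isRightDescent_iff, mul_assoc]
  have h1 := length_add_length_longest_mul cs w
  have h2 := length_add_length_longest_mul cs (w * cs.simple i)
  omega

/-- Left multiplication by the longest element. -/
noncomputable def longestMul : RightEnd W := MulOpposite.op fun w => longest cs * w

theorem act_longestMul (w : W) : act w (longestMul cs) = longest cs * w := rfl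

theorem longestMul_mul_longestMul : longestMul cs * longestMul cs = 1 := by
  refine rightEnd_ext fun w => ?_
  rw [act_mul, act_longestMul, act_longestMul, longest_mul_longest_mul, act_one]

/-- Conjugation by left multiplication with the longest element. -/
noncomputable def longestConj : RightEnd W →* RightEnd W where
  toFun f := longestMul cs * f * longestMul cs
  map_one' := by rw [mul_one, longestMul_mul_longestMul]
  map_mul' f g := by
    have := longestMul_mul_longestMul cs
    calc _ = longestMul cs * f * 1 * g * longestMul cs := by simp only [mul_assoc, one_mul]
      _ = _ := by rw [← this]; simp only [mul_assoc]

theorem act_longestConj (w : W) (f : RightEnd W) :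
    act w (longestConj cs f) = longest cs * act (longest cs * w) f := rfl

theorem longestConj_antisort (i : B) : longestConj cs (antisort cs i) = bubbleSort cs i := by
  refine rightEnd_ext fun w => ?_
  rw [act_longestConj]
  by_cases h : cs.IsRightDescent w i
  · rw [act_bubbleSort_of_descent h, act_antisort_of_not_descent, mul_assoc,
      longest_mul_longest_mul]
    rwa [isRightDescent_longest_mul, not_not]
  · rw [act_bubbleSort_of_not_descent h, act_antisort_of_descent, longest_mul_longest_mul]
    rwa [isRightDescent_longest_mul]

theorem longestConj_antisortElt (w : W) :
    longestConj cs (antisortElt cs w) = bubbleSortElt cs w := by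
  rw [antisortElt, bubbleSortElt, map_list_prod, List.map_map]
  congr 2
  funext i
  exact longestConj_antisort cs i

theorem act_bubbleSortElt {x y : W} (h : cs.length (x * y) + cs.length y = cs.length x) :
    act x (bubbleSortElt cs y) = x * y := by
  rw [← longestConj_antisortElt, act_longestConj, act_antisortElt, mul_assoc,
    longest_mul_longest_mul]
  have h1 := length_add_length_longest_mul cs x
  have h2 := length_add_length_longest_mul cs (x * y)
  rw [mul_assoc]
  omega

theorem bubbleSortElt_mul {x y : W} (h : cs.length (x * y) = cs.length x + cs.length y) :
    bubbleSortElt cs (x * y) = bubbleSortElt cs x * bubbleSortElt cs y := by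
  simp only [← longestConj_antisortElt, antisortElt_mul cs h, map_mul]

theorem bubbleSortElt_simple (i : B) : bubbleSortElt cs (cs.simple i) = bubbleSort cs i := by
  rw [← longestConj_antisortElt, antisortElt_simple, longestConj_antisort]

theorem bubbleSort_mul_bubbleSortElt {i : B} {w : W} (h : cs.IsLeftDescent w i) :
    bubbleSort cs i * bubbleSortElt cs w = bubbleSortElt cs w := by
  rw [← longestConj_antisortElt, ← longestConj_antisort, ← map_mul, antisort_mul_antisortElt cs h]

end Longest

end Operators

/-! ### The left weak order and its preservation by the biHecke monoid. -/

section WeakOrder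

variable {B W : Type*} [Group W] {M : CoxeterMatrix B} (cs : CoxeterSystem M W)

/-- The left weak order. -/
def WeakLE (u w : W) : Prop := cs.length (w * u⁻¹) + cs.length u = cs.length w

theorem weakLE_refl (w : W) : WeakLE cs w w := by simp [WeakLE]

theorem one_weakLE (w : W) : WeakLE cs 1 w := by simp [WeakLE]

variable {cs} in
theorem WeakLE.length_le {u w : W} (h : WeakLE cs u w) : cs.length u ≤ cs.length w := by
  unfold WeakLE at h
  omega

variable {cs} in
theorem WeakLE.eq_of_length_eq {u w : W} (h : WeakLE cs u w) (h' : cs.length u = cs.length w) :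
    u = w := by
  unfold WeakLE at h
  have : w * u⁻¹ = 1 := cs.length_eq_zero_iff.mp (by omega)
  exact (mul_inv_eq_one.mp this).symm

variable {cs} in
theorem WeakLE.antisymm {u w : W} (h : WeakLE cs u w) (h' : WeakLE cs w u) : u = w :=
  h.eq_of_length_eq (h.length_le.antisymm h'.length_le)

variable {cs} in
theorem WeakLE.simple_mul {u w : W} {j : B} (h : WeakLE cs u w) (hj : ¬ cs.IsLeftDescent w j) :
    WeakLE cs u (cs.simple j * w) := by
  rw [cs.not_isLeftDescent_iff] at hj
  unfold WeakLE at h ⊢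
  have h1 := cs.length_simple_mul (w * u⁻¹) j
  have h2 := cs.length_mul_le (cs.simple j * w * u⁻¹) u
  rw [inv_mul_cancel_right] at h2
  rw [mul_assoc] at h2 ⊢
  omega

/-- Induction along a saturated chain from `u` up to `w`, read off a reduced word of `w u⁻¹`. -/
theorem WeakLE.rec_on {u w : W} (h : WeakLE cs u w) {p : W → Prop} (base : p u)
    (step : ∀ x j, WeakLE cs u x → ¬ cs.IsLeftDescent x j → p x → p (cs.simple j * x)) : p w := by
  obtain ⟨ω, h1, h2⟩ := cs.exists_isReduced (w * u⁻¹)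
  obtain rfl : w = cs.wordProd ω * u := by rw [← h2, inv_mul_cancel_right]
  clear h2
  induction ω with
  | nil => simpa using base
  | cons i ω ih =>
    unfold WeakLE at h
    rw [mul_inv_cancel_right, h1.eq, cs.wordProd_cons, mul_assoc, List.length_cons] at h
    have h3 : cs.IsReduced ω := h1.drop 1
    have h4 := cs.length_simple_mul (cs.wordProd ω * u) i
    have h5 := cs.length_mul_le (cs.wordProd ω) u
    rw [h3.eq] at h5
    have h6 : WeakLE cs u (cs.wordProd ω * u) := by
      rw [WeakLE, mul_inv_cancel_right, h3.eq]
      omega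
    rw [cs.wordProd_cons, mul_assoc]
    refine step _ _ h6 ?_ (ih h3 h6)
    rw [cs.not_isLeftDescent_iff]
    omega

theorem WeakLE.exists_simple_mul {u w : W} (h : WeakLE cs u w) (hne : u ≠ w) :
    ∃ j, ¬ cs.IsLeftDescent u j ∧ WeakLE cs (cs.simple j * u) w := by
  suffices w = u ∨ ∃ j, ¬ cs.IsLeftDescent u j ∧ WeakLE cs (cs.simple j * u) w from
    this.resolve_left hne.symm
  refine h.rec_on cs
    (p := fun w => w = u ∨ ∃ j, ¬ cs.IsLeftDescent u j ∧ WeakLE cs (cs.simple j * u) w)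
    (.inl rfl) ?_
  rintro x j - hj (rfl | ⟨k, hk, hk'⟩)
  · exact .inr ⟨j, hj, weakLE_refl cs _⟩
  · exact .inr ⟨k, hk, hk'.simple_mul hj⟩

/-- Elements of the biHecke monoid map an edge of the left weak order to an edge with the same
label, or collapse it. -/
theorem act_simple_mul {f : RightEnd W} (hf : f ∈ biHeckeMonoid cs) {w : W} {j : B}
    (hj : ¬ cs.IsLeftDescent w j) :
    act (cs.simple j * w) f = act w f ∨
      act (cs.simple j * w) f = cs.simple j * act w f ∧ ¬ cs.IsLeftDescent (act w f) j := by
  induction hf using Submonoid.closure_induction generalizing w with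
  | one => exact .inr ⟨rfl, hj⟩
  | mul f g _ _ ihf ihg =>
    simp only [act_mul]
    rcases ihf hj with h | ⟨h, h'⟩
    · exact .inl (by rw [h])
    · rw [h]
      exact ihg h'
  | mem f hf =>
    rcases hf with ⟨i, rfl⟩ | ⟨i, rfl⟩
    · have h := leftAntisort_act_antisort cs w i j
      rw [leftAntisort_of_not_descent hj] at h
      rw [← h]
      by_cases hj' : cs.IsLeftDescent (act w (antisort cs i)) j
      · exact .inl (leftAntisort_of_descent hj')
      · exact .inr ⟨leftAntisort_of_not_descent hj', hj'⟩
    · by_cases hi : cs.IsRightDescent w i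
      · rw [act_bubbleSort_of_descent hi,
          act_bubbleSort_of_descent (isRightDescent_simple_mul hi hj), mul_assoc]
        exact .inr ⟨rfl, not_isLeftDescent_mul_simple hi hj⟩
      · rw [act_bubbleSort_of_not_descent hi]
        -- If `i` is a descent of `s_j w` only, the lifting property gives `s_j w = w s_i`, and
        -- sorting collapses the edge onto `w`.
        by_cases hi' : cs.IsRightDescent (cs.simple j * w) i
        · rw [act_bubbleSort_of_descent hi', simple_mul_eq_mul_simple cs hi hi',
            cs.simple_mul_simple_cancel_right]
          exact .inl rfl
        · rw [act_bubbleSort_of_not_descent hi']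
          exact .inr ⟨rfl, hj⟩

/-- Edges along a chain are kept or collapsed. The second part, written without subtraction, says
that the length difference does not grow. -/
theorem WeakLE.act {f : RightEnd W} (hf : f ∈ biHeckeMonoid cs) {u w : W} (h : WeakLE cs u w) :
    WeakLE cs (act u f) (act w f) ∧
      cs.length (BiHecke.act w f) + cs.length u ≤ cs.length (BiHecke.act u f) + cs.length w := by
  refine h.rec_on cs (p := fun w => WeakLE cs (BiHecke.act u f) (BiHecke.act w f) ∧
    cs.length (BiHecke.act w f) + cs.length u ≤ cs.length (BiHecke.act u f) + cs.length w)
    ⟨weakLE_refl cs _, le_rfl⟩ ?_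
  rintro x j - hj ⟨h1, h2⟩
  have h3 := cs.not_isLeftDescent_iff.mp hj
  rcases act_simple_mul cs hf hj with h | ⟨h, h'⟩
  · rw [h]
    exact ⟨h1, by omega⟩
  · rw [h]
    have h4 := cs.not_isLeftDescent_iff.mp h'
    exact ⟨h1.simple_mul h', by omega⟩

/-! ### Fixed points of elements of the Borel submonoid. -/

section Borel

variable {cs} {f g : RightEnd W}

theorem length_act_le (hf : f ∈ borel cs) (w : W) :
    cs.length (act w f) ≤ cs.length w := by
  have := ((one_weakLE cs w).act cs hf.1).2
  rwa [hf.2, cs.length_one, add_zero, zero_add] at this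

theorem act_eq_of_length_eq (hf : f ∈ borel cs) {w : W}
    (h : cs.length (act w f) = cs.length w) : act w f = w := by
  revert h
  refine (one_weakLE cs w).rec_on cs
    (p := fun w => cs.length (act w f) = cs.length w → act w f = w) (fun _ => hf.2) ?_
  intro x j _ hj ih h
  have h1 := cs.not_isLeftDescent_iff.mp hj
  have h2 := length_act_le hf x
  rcases act_simple_mul cs hf.1 hj with h3 | ⟨h3, h4⟩
  · rw [h3] at h
    omega
  · have h5 := cs.not_isLeftDescent_iff.mp h4
    rw [h3] at h ⊢
    rw [ih (by omega)]

theorem act_eq_of_weakLE (hf : f ∈ borel cs) {u w : W} (h : WeakLE cs u w) (hw : act w f = w) :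
    act u f = u := by
  apply act_eq_of_length_eq hf
  have h1 := (h.act cs hf.1).2
  have h2 := length_act_le hf u
  rw [hw] at h1
  omega

theorem act_eq_of_act_mul_eq (hf : f ∈ borel cs) (hg : g ∈ borel cs) {w : W}
    (h : act w (f * g) = w) : act w f = w ∧ act w g = w := by
  have h1 := length_act_le hf w
  have h2 := length_act_le hg (act w f)
  rw [act_mul] at h
  rw [h] at h2
  have h3 := act_eq_of_length_eq hf (h1.antisymm h2)
  rw [h3] at h
  exact ⟨h3, h⟩

end Borel

theorem antisortElt_mem (w : W) : antisortElt cs w ∈ biHeckeMonoid cs := by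
  apply Submonoid.list_prod_mem
  intro x hx
  obtain ⟨i, -, rfl⟩ := List.mem_map.mp hx
  exact Submonoid.subset_closure (.inl ⟨i, rfl⟩)

theorem bubbleSortElt_mem (w : W) : bubbleSortElt cs w ∈ biHeckeMonoid cs := by
  apply Submonoid.list_prod_mem
  intro x hx
  obtain ⟨i, -, rfl⟩ := List.mem_map.mp hx
  exact Submonoid.subset_closure (.inr ⟨i, rfl⟩)

/-! ### The idempotents `e_w`. -/

section Idempotents

variable [Finite W]

theorem weakLE_longest (w : W) : WeakLE cs w (longest cs) := by
  have := length_add_length_longest_mul cs w⁻¹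
  rw [cs.length_inv] at this
  unfold WeakLE
  omega

/-- The element `π_v π̄_{v⁻¹}`. -/
noncomputable def sortIdempotent (v : W) : RightEnd W :=
  antisortElt cs v * bubbleSortElt cs v⁻¹

theorem e_eq_sortIdempotent (w : W) : e cs w = sortIdempotent cs (w⁻¹ * longest cs) := by
  rw [e, sortIdempotent, mul_inv_rev, inv_inv, longest_inv]

theorem sortIdempotent_eq_e (v : W) : sortIdempotent cs v = e cs (longest cs * v⁻¹) := by
  rw [e_eq_sortIdempotent, mul_inv_rev, inv_inv, longest_inv, mul_assoc, longest_mul_longest,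
    mul_one]

theorem act_self_bubbleSortElt_inv (v : W) : act v (bubbleSortElt cs v⁻¹) = 1 := by
  rw [act_bubbleSortElt, mul_inv_cancel]
  simp

theorem act_bubbleSortElt_mul_antisortElt {v x : W} (h : WeakLE cs v x) :
    act (act x (bubbleSortElt cs v⁻¹)) (antisortElt cs v) = x := by
  unfold WeakLE at h
  rw [act_bubbleSortElt, act_antisortElt, inv_mul_cancel_right]
  · rw [inv_mul_cancel_right, h]
  · rwa [cs.length_inv]

/-- The image of `f` lies above `v = 1.f` in the weak order, and there sorting by `v⁻¹` followed by
antisorting by `v` is the identity. This yields both the idempotency of `e_w` and the relation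
`antisortElt_mul_bubbleSort`. -/
theorem mul_bubbleSortElt_mul_antisortElt {f : RightEnd W} (hf : f ∈ biHeckeMonoid cs) :
    f * (bubbleSortElt cs (act 1 f)⁻¹ * antisortElt cs (act 1 f)) = f := by
  refine rightEnd_ext fun x => ?_
  rw [act_mul, act_mul]
  exact act_bubbleSortElt_mul_antisortElt cs ((one_weakLE cs x).act cs hf).1

theorem sortIdempotent_mul_antisortElt (v : W) :
    sortIdempotent cs v * antisortElt cs v = antisortElt cs v := by
  have := mul_bubbleSortElt_mul_antisortElt cs (antisortElt_mem cs v)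
  rwa [act_one_antisortElt, ← mul_assoc] at this

theorem sortIdempotent_mem_borel (v : W) : sortIdempotent cs v ∈ borel cs := by
  refine ⟨mul_mem (antisortElt_mem cs v) (bubbleSortElt_mem cs _), ?_⟩
  rw [sortIdempotent, act_mul, act_one_antisortElt, act_self_bubbleSortElt_inv]

theorem e_mem_borel (w : W) : e cs w ∈ borel cs := by
  rw [e_eq_sortIdempotent]
  exact sortIdempotent_mem_borel cs _

theorem isIdempotentElem_e (w : W) : IsIdempotentElem (e cs w) := by
  rw [e_eq_sortIdempotent, IsIdempotentElem]
  conv_lhs => rw [sortIdempotent.eq_1 cs (w⁻¹ * longest cs)]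
  rw [← mul_assoc]
  change sortIdempotent cs _ * antisortElt cs _ * _ = _
  rw [sortIdempotent_mul_antisortElt, sortIdempotent]

theorem act_antisortElt_inv_mul_longest (w : W) :
    act w (antisortElt cs (w⁻¹ * longest cs)) = longest cs := by
  rw [act_antisortElt, mul_inv_cancel_left]
  rw [mul_inv_cancel_left, length_add_length_inv_mul_longest]

theorem act_longest_bubbleSortElt (w : W) :
    act (longest cs) (bubbleSortElt cs (longest cs * w)) = w := by
  rw [act_bubbleSortElt, longest_mul_longest_mul]
  rw [longest_mul_longest_mul, length_add_length_longest_mul]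

theorem act_self_e (w : W) : act w (e cs w) = w := by
  rw [e, act_mul, act_antisortElt_inv_mul_longest, act_longest_bubbleSortElt]

theorem act_longest_e (w : W) : act (longest cs) (e cs w) = w := by
  rw [e, act_mul]
  have : act (longest cs) (antisortElt cs (w⁻¹ * longest cs)) = longest cs :=
    act_antisortWord_of_maximal cs (length_le_longest cs) _
  rw [this, act_longest_bubbleSortElt]

theorem act_e_eq_iff {x w : W} : act x (e cs w) = x ↔ WeakLE cs x w := by
  constructor
  · intro h
    have := ((weakLE_longest cs x).act cs (e_mem_borel cs w).1).1
    rwa [h, act_longest_e] at this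
  · intro h
    exact act_eq_of_weakLE (e_mem_borel cs w) h (act_self_e cs w)

theorem e_injective : Function.Injective (e cs) := by
  intro u w h
  apply WeakLE.antisymm (cs := cs)
  · rw [← act_e_eq_iff, ← h, act_self_e]
  · rw [← act_e_eq_iff, h, act_self_e]

theorem e_longest : e cs (longest cs) = 1 := by
  refine rightEnd_ext fun x => ?_
  rw [act_one, act_e_eq_iff]
  exact weakLE_longest cs x

theorem weakLE_act_e (x w : W) : WeakLE cs (act x (e cs w)) w := by
  rw [← act_e_eq_iff, ← act_mul, isIdempotentElem_e]

theorem e_mul_of_act_eq {f : RightEnd W} (hf : f ∈ borel cs) {w : W} (h : act w f = w) :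
    e cs w * f = e cs w := by
  refine rightEnd_ext fun x => ?_
  rw [act_mul]
  exact act_eq_of_weakLE hf (weakLE_act_e cs x w) h

/-- For `w ≤ u` the element `w⁻¹ w_0` has `u⁻¹ w_0` as a reduced prefix, so `e_w` starts with an
antisorting operator that `e_u` fixes from the left. -/
theorem e_mul_e_of_weakLE {u w : W} (h : WeakLE cs w u) : e cs u * e cs w = e cs w := by
  have hv : w⁻¹ * longest cs = (u⁻¹ * longest cs) * (longest cs * (u * w⁻¹) * longest cs) := by
    have := longest_mul_longest cs
    calc _ = u⁻¹ * 1 * u * w⁻¹ * longest cs := by group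
      _ = _ := by rw [← this]; simp only [mul_assoc]
  have hlen : cs.length (longest cs * (u * w⁻¹) * longest cs) = cs.length (u * w⁻¹) := by
    have h1 := length_add_length_longest_mul cs (u * w⁻¹)
    have h2 := length_add_length_inv_mul_longest cs (longest cs * (u * w⁻¹))⁻¹
    rw [inv_inv, cs.length_inv] at h2
    omega
  have h1 := length_add_length_inv_mul_longest cs u
  have h2 := length_add_length_inv_mul_longest cs w
  unfold WeakLE at h
  have h3 := antisortElt_mul cs (x := u⁻¹ * longest cs)
    (y := longest cs * (u * w⁻¹) * longest cs) (by rw [← hv, hlen]; omega)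
  rw [← hv] at h3
  conv_lhs => rw [e.eq_1 cs w, h3]
  rw [e_eq_sortIdempotent cs u, ← mul_assoc, ← mul_assoc, sortIdempotent_mul_antisortElt, ← h3, e]

end Idempotents

/-! ### The Grassmannian idempotents generate. -/

section Generation

variable [Finite W]

/-- The word plays the part of the longest element of the parabolic subgroup of `J`. It is found by
maximizing the length of the image of `1` over words in `J`. -/
theorem exists_absorbing_word (J : Set B) : ∃ ω : List B, (∀ i ∈ ω, i ∈ J) ∧
    ∀ i ∈ J, antisortWord cs ω * antisort cs i = antisortWord cs ω ∧
      antisort cs i * antisortWord cs ω = antisortWord cs ω := by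
  let S := {t : W | ∃ ω : List B, (∀ i ∈ ω, i ∈ J) ∧ act 1 (antisortWord cs ω) = t}
  obtain ⟨t, ⟨ω, hω, ht⟩, hmax⟩ := S.exists_max_image cs.length S.toFinite
    ⟨1, [], by simp, rfl⟩
  have hsingle : ∀ i, antisortWord cs [i] = antisort cs i := fun i => by
    rw [antisortWord_cons, antisortWord_nil, mul_one]
  have hfix : ∀ i ∈ J, act t (antisort cs i) = t := by
    intro i hi
    by_cases h : cs.IsRightDescent t i
    · exact act_antisort_of_descent h
    · have h1 := hmax (t * cs.simple i) ⟨ω ++ [i], by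
        simpa [or_imp, forall_and] using ⟨hω, hi⟩, by
        rw [antisortWord_append, act_mul, ht, hsingle, act_antisort_of_not_descent h]⟩
      have h2 := cs.not_isRightDescent_iff.mp h
      omega
  have hfixWord : ∀ ν : List B, (∀ i ∈ ν, i ∈ J) → act t (antisortWord cs ν) = t := by
    intro ν hν
    induction ν with
    | nil => rfl
    | cons i ν ih =>
      rw [antisortWord_cons, act_mul, hfix i (hν i (by simp)), ih fun i hi => hν i (by simp [hi])]
  -- `t` is also the image of `1` under the palindrome `ω ω.reverse`, and reversing a word inverts
  -- that image.
  have hinv : t⁻¹ = t := by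
    have h1 : act 1 (antisortWord cs (ω ++ ω.reverse)) = t := by
      rw [antisortWord_append, act_mul, ht, hfixWord]
      simpa using hω
    have h2 := inv_act_one_antisortWord cs (ω ++ ω.reverse)
    rwa [List.reverse_append, List.reverse_reverse, h1] at h2
  refine ⟨ω, hω, fun i hi => ⟨?_, ?_⟩⟩
  · rw [← hsingle, ← antisortWord_append]
    apply antisortWord_eq_of_act_one
    rw [antisortWord_append, act_mul, ht, hsingle, hfix i hi]
  · rw [← antisortWord_cons]
    apply antisortWord_eq_of_act_one
    rw [← inv_inj, inv_act_one_antisortWord, List.reverse_cons, antisortWord_append, act_mul,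
      ← inv_act_one_antisortWord, ht, hinv, hsingle, hfix i hi]

theorem bubbleSortElt_simple_mul {w : W} {i : B} (h : ¬ cs.IsRightDescent w i) :
    bubbleSortElt cs (w * cs.simple i)⁻¹ = bubbleSort cs i * bubbleSortElt cs w⁻¹ := by
  rw [mul_inv_rev, cs.inv_simple, bubbleSortElt_mul, bubbleSortElt_simple]
  have := cs.length_inv (w * cs.simple i)
  rw [mul_inv_rev, cs.inv_simple, cs.not_isRightDescent_iff.mp h] at this
  rw [this, cs.length_simple, cs.length_inv, add_comm]

/-- The left side sends `1` to `v`, so it absorbs `π̄_{v⁻¹} π_v` on the right. Replacing `π̄_i` by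
`π_i π̄_i` then exhibits the idempotent of `v s_i`. -/
theorem antisortElt_mul_bubbleSort {v : W} {i : B} (h : ¬ cs.IsRightDescent v i) :
    antisortElt cs v * bubbleSort cs i =
      sortIdempotent cs (v * cs.simple i) * antisortElt cs v := by
  have h1 : antisortElt cs v * bubbleSort cs i ∈ biHeckeMonoid cs :=
    mul_mem (antisortElt_mem cs v) (Submonoid.subset_closure (.inr ⟨i, rfl⟩))
  have h2 := mul_bubbleSortElt_mul_antisortElt cs h1
  have h3 : act 1 (antisortElt cs v * bubbleSort cs i) = v := by
    rw [act_mul, act_one_antisortElt, act_bubbleSort_of_not_descent h]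
  rw [h3] at h2
  rw [← h2, sortIdempotent, antisortElt_mul_simple cs h, bubbleSortElt_simple_mul cs h]
  conv_lhs => rw [← antisort_mul_bubbleSort]
  simp only [mul_assoc]

theorem exists_antisortElt_mul (v : W) {f : RightEnd W}
    (hf : f ∈ Set.range (antisort cs) ∪ Set.range (bubbleSort cs)) :
    ∃ m ∈ Submonoid.closure (Set.range (e cs)),
      antisortElt cs v * f = m * antisortElt cs (act v f) := by
  have hmem : ∀ v, sortIdempotent cs v ∈ Submonoid.closure (Set.range (e cs)) := fun v =>
    Submonoid.subset_closure ⟨_, (sortIdempotent_eq_e cs v).symm⟩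
  rcases hf with ⟨i, rfl⟩ | ⟨i, rfl⟩ <;> by_cases h : cs.IsRightDescent v i
  · exact ⟨1, one_mem _, by rw [one_mul, act_antisort_of_descent h, antisortElt_mul_antisort cs h]⟩
  · exact ⟨1, one_mem _, by
      rw [one_mul, act_antisort_of_not_descent h, antisortElt_mul_simple cs h]⟩
  · obtain ⟨u, rfl⟩ : ∃ u, v = u * cs.simple i := ⟨v * cs.simple i, by simp⟩
    refine ⟨_, hmem (u * cs.simple i), ?_⟩
    rw [act_bubbleSort_of_descent h, cs.simple_mul_simple_cancel_right]
    rw [cs.isRightDescent_iff_not_isRightDescent_mul, cs.simple_mul_simple_cancel_right] at h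
    rw [antisortElt_mul_simple cs h, mul_assoc, antisort_mul_bubbleSort,
      antisortElt_mul_bubbleSort cs h]
  · refine ⟨_, hmem (v * cs.simple i), ?_⟩
    rw [act_bubbleSort_of_not_descent h, antisortElt_mul_bubbleSort cs h]

theorem exists_mul_antisortElt {f : RightEnd W} (hf : f ∈ biHeckeMonoid cs) :
    ∃ m ∈ Submonoid.closure (Set.range (e cs)), f = m * antisortElt cs (act 1 f) := by
  induction hf using Submonoid.closure_induction_right with
  | one => exact ⟨1, one_mem _, by rw [act_one, antisortElt_one, mul_one]⟩
  | mul_right f _ g hg ih =>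
    obtain ⟨m, hm, h⟩ := ih
    obtain ⟨m', hm', h'⟩ := exists_antisortElt_mul cs (act 1 f) hg
    refine ⟨m * m', mul_mem hm hm', ?_⟩
    rw [act_mul, mul_assoc, ← h', ← mul_assoc, ← h]

theorem closure_range_e : Submonoid.closure (Set.range (e cs)) = borel cs := by
  apply le_antisymm
  · rw [Submonoid.closure_le]
    rintro _ ⟨w, rfl⟩
    exact e_mem_borel cs w
  · rintro f ⟨hf, hf1⟩
    obtain ⟨m, hm, h⟩ := exists_mul_antisortElt cs hf
    rw [hf1, antisortElt_one, mul_one] at h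
    rwa [h]

theorem exists_conj_longest_eq (i : B) :
    ∃ j, longest cs * cs.simple i * longest cs = cs.simple j := by
  rw [← cs.length_eq_one_iff]
  have h1 := length_add_length_longest_mul cs (cs.simple i)
  have h2 := length_add_length_inv_mul_longest cs (longest cs * cs.simple i)⁻¹
  rw [inv_inv, cs.length_inv] at h2
  rw [cs.length_simple] at h1
  omega

-- Conjugation by `w_0` permutes the simple reflections, carrying descents to descents. Distinctness
-- of the simple reflections is needed to recover the index.
variable {cs} in
theorem IsGrassmannian.conj_longest {v : W} (h : IsGrassmannian cs v) :
    IsGrassmannian cs (longest cs * v * longest cs) := by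
  have key : ∀ i, cs.IsRightDescent (longest cs * v * longest cs) i →
      ∃ j, cs.IsRightDescent v j ∧ longest cs * cs.simple i * longest cs = cs.simple j := by
    intro i hi
    obtain ⟨j, hj⟩ := exists_conj_longest_eq cs i
    refine ⟨j, ?_, hj⟩
    rw [mul_assoc, isRightDescent_longest_mul, cs.not_isRightDescent_iff] at hi
    have h1 : v * longest cs * cs.simple i = v * cs.simple j * longest cs := by
      rw [← hj]
      simp only [mul_assoc, longest_mul_longest, mul_one]
    have h2 := length_add_length_inv_mul_longest cs (v * cs.simple j)⁻¹
    have h3 := length_add_length_inv_mul_longest cs v⁻¹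
    rw [inv_inv, cs.length_inv] at h2 h3
    rw [h1] at hi
    unfold IsRightDescent
    omega
  intro i hi j hj
  obtain ⟨i', hi1, hi2⟩ := key i hi
  obtain ⟨j', hj1, hj2⟩ := key j hj
  obtain rfl := h hi1 hj1
  rw [← hj2] at hi2
  exact simple_injective cs (mul_left_cancel (mul_right_cancel hi2))

theorem sortIdempotent_mem_grassmannianIdempotents {v : W} (h : IsGrassmannian cs v) :
    sortIdempotent cs v ∈ grassmannianIdempotents cs := by
  refine ⟨longest cs * v⁻¹, ?_, sortIdempotent_eq_e cs v⟩
  rw [mul_inv_rev, inv_inv, longest_inv, ← mul_assoc]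
  exact h.conj_longest

/-- An absorbing word for `{a, b}` sends `v s_a` to `v`. If `b` were not a descent of `v s_a`, this
word would pass through `v s_a s_b`, which already has the length of `v`, forcing `s_a = s_b`. -/
theorem exists_descent_mul_simple {v : W} {a b : B} (hab : a ≠ b) (ha : cs.IsRightDescent v a)
    (hb : cs.IsRightDescent v b) : cs.IsRightDescent (v * cs.simple a) b := by
  by_contra h
  have ha' := cs.isRightDescent_iff_not_isRightDescent_mul.mp ha
  obtain ⟨ω, hω, habs⟩ := exists_absorbing_word cs {a, b}
  have hv : act v (antisortWord cs ω) = v := by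
    apply act_antisortWord_of_descents
    intro i hi
    rcases hω i hi with rfl | rfl
    exacts [ha, hb]
  have h1 : act (v * cs.simple a) (antisortWord cs ω) = v := by
    rw [← (habs a (by simp)).2, act_mul, act_antisort_of_not_descent ha',
      cs.simple_mul_simple_cancel_right, hv]
  rw [← (habs b (by simp)).2, act_mul, act_antisort_of_not_descent h] at h1
  obtain ⟨y, h2, h3⟩ := exists_act_antisortWord cs (v * cs.simple a * cs.simple b) ω
  rw [← h2, h1, cs.not_isRightDescent_iff.mp h] at h3
  have h4 := cs.isRightDescent_iff.mp ha
  have hy : y = 1 := cs.length_eq_zero_iff.mp (by omega)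
  rw [h1, hy, mul_one, mul_assoc] at h2
  apply hab
  apply simple_injective cs
  rw [mul_eq_one_iff_eq_inv.mp (left_eq_mul.mp h2), cs.inv_simple]

/-- The idempotents of the elements with several descents decompose. -/
theorem sortIdempotent_mem_closure_of_descents {N : Submonoid (RightEnd W)} {v : W} {a b : B}
    (hab : a ≠ b) (ha : cs.IsRightDescent v a) (hb : cs.IsRightDescent v b)
    (hN : ∀ u, cs.length u < cs.length v → sortIdempotent cs u ∈ N) :
    sortIdempotent cs v ∈ N := by
  obtain ⟨ω, hω, habs⟩ := exists_absorbing_word cs {a, b}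
  have hbword : ∀ i, longestConj cs (antisort cs i) = bubbleSort cs i := longestConj_antisort cs
  -- The sorting counterpart of the absorbing word; it lets `π_y p π̄_{y⁻¹}` stay constant when `y`
  -- moves by `s_a` or `s_b`.
  set p := longestConj cs (antisortWord cs ω) with hp
  have hpl : ∀ c ∈ ({a, b} : Set B), antisort cs c * p = p := by
    intro c hc
    have : bubbleSort cs c * p = p := by rw [hp, ← hbword, ← map_mul, (habs c hc).2]
    rw [← this, ← mul_assoc, antisort_mul_bubbleSort]
  have hpr : ∀ c ∈ ({a, b} : Set B), p * bubbleSort cs c = p := by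
    intro c hc
    rw [hp, ← hbword, ← map_mul, (habs c hc).1]
  have hstep : ∀ y, ∀ c ∈ ({a, b} : Set B), ¬ cs.IsRightDescent y c →
      antisortElt cs (y * cs.simple c) * p * bubbleSortElt cs (y * cs.simple c)⁻¹ =
        antisortElt cs y * p * bubbleSortElt cs y⁻¹ := by
    intro y c hc hy
    rw [antisortElt_mul_simple cs hy, bubbleSortElt_simple_mul cs hy, mul_assoc _ (antisort cs c),
      hpl c hc, ← mul_assoc, mul_assoc _ p, hpr c hc]
  have hdown : ∀ n x, cs.length x = n → ∃ u, ¬ cs.IsRightDescent u a ∧ ¬ cs.IsRightDescent u b ∧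
      cs.length u ≤ cs.length x ∧ antisortElt cs x * p * bubbleSortElt cs x⁻¹ =
        antisortElt cs u * p * bubbleSortElt cs u⁻¹ := by
    intro n
    induction n using Nat.strong_induction_on with
    | _ n ih =>
      intro x hx
      by_cases h : ∃ c ∈ ({a, b} : Set B), cs.IsRightDescent x c
      · obtain ⟨c, hc, hxc⟩ := h
        have h1 := cs.isRightDescent_iff.mp hxc
        obtain ⟨u, hu1, hu2, hu3, hu4⟩ := ih _ (by omega) (x * cs.simple c) rfl
        refine ⟨u, hu1, hu2, by omega, ?_⟩
        rw [← hu4, ← hstep _ c hc (cs.isRightDescent_iff_not_isRightDescent_mul.mp hxc),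
          cs.simple_mul_simple_cancel_right]
      · push Not at h
        exact ⟨x, h a (by simp), h b (by simp), le_rfl, rfl⟩
  have hvp : sortIdempotent cs v = antisortElt cs v * p * bubbleSortElt cs v⁻¹ := by
    have : ∀ ν : List B, (∀ i ∈ ν, i ∈ ({a, b} : Set B)) →
        longestConj cs (antisortWord cs ν) * bubbleSortElt cs v⁻¹ = bubbleSortElt cs v⁻¹ := by
      intro ν hν
      induction ν with
      | nil => rw [antisortWord_nil, map_one, one_mul]
      | cons i ν ih =>
        rw [antisortWord_cons, map_mul, hbword, mul_assoc, ih fun i hi => hν i (by simp [hi]),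
          bubbleSort_mul_bubbleSortElt]
        rw [cs.isLeftDescent_inv_iff]
        rcases hν i (by simp) with rfl | rfl
        exacts [ha, hb]
    rw [mul_assoc, this ω hω, sortIdempotent]
  -- Descending from `v s_a s_b` makes `u` shorter than `v` by at least two, so that `u s_a` and `u
  -- s_b` are still shorter than `v`.
  have hb' := exists_descent_mul_simple cs hab ha hb
  obtain ⟨u, hua, hub, hlen, hu⟩ := hdown _ (v * cs.simple a * cs.simple b) rfl
  have hl1 := cs.isRightDescent_iff.mp ha
  have hl2 := cs.isRightDescent_iff.mp hb'
  rw [← hstep _ b (by simp) (cs.isRightDescent_iff_not_isRightDescent_mul.mp hb'),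
    cs.simple_mul_simple_cancel_right,
    ← hstep _ a (by simp) (cs.isRightDescent_iff_not_isRightDescent_mul.mp ha),
    cs.simple_mul_simple_cancel_right, ← hvp] at hu
  -- Since `a` and `b` are non-descents of `u`, each sorting letter of `p` crosses `π_u` at the cost
  -- of an idempotent of `u s_a` or `u s_b`. What remains is the idempotent of `u`.
  have hpush : ∀ ν : List B, (∀ i ∈ ν, i ∈ ({a, b} : Set B)) → ∃ m ∈ N,
      antisortElt cs u * longestConj cs (antisortWord cs ν) = m * antisortElt cs u := by
    intro ν hν
    induction ν with
    | nil => exact ⟨1, one_mem _, by rw [antisortWord_nil, map_one, one_mul, mul_one]⟩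
    | cons i ν ih =>
      obtain ⟨m, hm, h⟩ := ih fun i hi => hν i (by simp [hi])
      have hui : ¬ cs.IsRightDescent u i := by
        rcases hν i (by simp) with rfl | rfl
        exacts [hua, hub]
      have hli := cs.not_isRightDescent_iff.mp hui
      refine ⟨sortIdempotent cs (u * cs.simple i) * m, mul_mem (hN _ (by omega)) hm, ?_⟩
      rw [antisortWord_cons, map_mul, hbword, ← mul_assoc, antisortElt_mul_bubbleSort cs hui,
        mul_assoc, h, mul_assoc]
  obtain ⟨m, hm, h⟩ := hpush ω hω
  rw [hu, h, mul_assoc]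
  exact mul_mem hm (hN u (by omega))

theorem sortIdempotent_mem_closure (v : W) :
    sortIdempotent cs v ∈ Submonoid.closure (grassmannianIdempotents cs) := by
  induction hn : cs.length v using Nat.strong_induction_on generalizing v with
  | _ n ih =>
    by_cases h : IsGrassmannian cs v
    · exact Submonoid.subset_closure (sortIdempotent_mem_grassmannianIdempotents cs h)
    · obtain ⟨a, ha, b, hb, hab⟩ := Set.not_subsingleton_iff.mp h
      exact sortIdempotent_mem_closure_of_descents cs hab ha hb fun u hu => ih _ (hn ▸ hu) u rfl

theorem generatesAsMonoid_grassmannianIdempotents :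
    GeneratesAsMonoid (borel cs) (grassmannianIdempotents cs) := by
  rw [GeneratesAsMonoid, ← closure_range_e]
  apply le_antisymm
  · rw [Submonoid.closure_le]
    rintro _ ⟨w, -, rfl⟩
    exact Submonoid.subset_closure ⟨w, rfl⟩
  · rw [Submonoid.closure_le]
    rintro _ ⟨w, rfl⟩
    rw [e_eq_sortIdempotent]
    exact sortIdempotent_mem_closure cs _

end Generation

end WeakOrder

/-! ### Comparison of the two notions of generation. -/

section Generates

variable {B W : Type*} [Group W] {M : CoxeterMatrix B} {cs : CoxeterSystem M W}

theorem Generates.generatesAsMonoid {X : Set (RightEnd W)} (hX : Generates (borel cs) X) :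
    GeneratesAsMonoid (borel cs) X := by
  apply le_antisymm
  · rw [Submonoid.closure_le]
    intro f hf
    change f ∈ (borel cs).toSubsemigroup
    rw [← hX]
    exact Subsemigroup.subset_closure hf
  · intro f hf
    change f ∈ (borel cs).toSubsemigroup at hf
    rw [← hX] at hf
    exact (Subsemigroup.closure_le (S := (Submonoid.closure X).toSubsemigroup)).mpr
      Submonoid.subset_closure hf

theorem Generates.one_mem {X : Set (RightEnd W)} (hX : Generates (borel cs) X) : 1 ∈ X := by
  have key : ∀ f ∈ Subsemigroup.closure X, f = 1 → 1 ∈ X := by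
    intro f hf h
    induction hf using Subsemigroup.closure_induction with
    | mem f hf => exact h ▸ hf
    | mul f g hf hg ihf ihg =>
      rw [hX] at hf hg
      exact ihf (rightEnd_ext fun w => (act_eq_of_act_mul_eq hf hg (by rw [h, act_one])).1)
  refine key 1 ?_ rfl
  rw [hX]
  exact Submonoid.one_mem (borel cs)

end Generates

/-! ### Minimality: the Grassmannian idempotents are indispensable. -/

section Generators

variable {B W : Type*} [Group W] [Finite W] {M : CoxeterMatrix B} (cs : CoxeterSystem M W)

theorem isGrassmannian_longest_mul_inv {w : W} :
    IsGrassmannian cs (longest cs * w⁻¹) ↔ {j | ¬ cs.IsLeftDescent w j}.Subsingleton := by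
  simp only [IsGrassmannian, isRightDescent_longest_mul, cs.isRightDescent_inv_iff]

theorem mul_e_of_act_eq {f : RightEnd W} (hf : f ∈ borel cs) {w : W} (h : act w f = w) :
    f * e cs w = e cs w := by
  rw [← closure_range_e] at hf
  induction hf using Submonoid.closure_induction with
  | one => rw [one_mul]
  | mem f hf =>
    obtain ⟨u, rfl⟩ := hf
    exact e_mul_e_of_weakLE cs ((act_e_eq_iff cs).mp h)
  | mul f g hf hg ihf ihg =>
    rw [closure_range_e] at hf hg
    obtain ⟨h1, h2⟩ := act_eq_of_act_mul_eq hf hg h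
    rw [mul_assoc, ihg h2, ihf h1]

/-- For `f = e_u` with `w < u`, some upper cover of `w` lies below `u`, and `s w` is the only upper
cover. For products, `e_w` is absorbing among the Borel elements that fix `w`. -/
theorem act_simple_mul_eq_or_eq_e {f : RightEnd W} (hf : f ∈ borel cs) {w : W} {s : B}
    (hs : ∀ j, ¬ cs.IsLeftDescent w j → j = s) (h : act w f = w) :
    act (cs.simple s * w) f = cs.simple s * w ∨ f = e cs w := by
  rw [← closure_range_e] at hf
  induction hf using Submonoid.closure_induction with
  | one => exact .inl rfl
  | mem f hf =>
    obtain ⟨u, rfl⟩ := hf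
    rw [act_e_eq_iff] at h ⊢
    by_cases hne : w = u
    · exact .inr (by rw [hne])
    · obtain ⟨j, hj, hj'⟩ := h.exists_simple_mul cs hne
      rw [← hs j hj]
      exact .inl hj'
  | mul f g hf hg ihf ihg =>
    rw [closure_range_e] at hf hg
    obtain ⟨h1, h2⟩ := act_eq_of_act_mul_eq hf hg h
    rcases ihf h1 with h3 | rfl
    · rcases ihg h2 with h4 | rfl
      · exact .inl (by rw [act_mul, h3, h4])
      · exact .inr (mul_e_of_act_eq cs hf h1)
    · exact .inr (e_mul_of_act_eq cs hg h2)

variable {cs} in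
theorem e_mem_of_generatesAsMonoid {X : Set (RightEnd W)} (hX : GeneratesAsMonoid (borel cs) X)
    {w : W} (hw : IsGrassmannian cs (longest cs * w⁻¹)) (hne : e cs w ≠ 1) : e cs w ∈ X := by
  have hw0 : w ≠ longest cs := by
    rintro rfl
    exact hne (e_longest cs)
  obtain ⟨s, hs, -⟩ := (weakLE_longest cs w).exists_simple_mul cs hw0
  have hs' : ∀ j, ¬ cs.IsLeftDescent w j → j = s := fun j hj =>
    (isGrassmannian_longest_mul_inv cs).mp hw hj hs
  have key : ∀ f ∈ Submonoid.closure X, act w f = w →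
      act (cs.simple s * w) f = cs.simple s * w ∨ e cs w ∈ X := by
    intro f hf h
    induction hf using Submonoid.closure_induction with
    | one => exact .inl rfl
    | mem f hf =>
      have hf' : f ∈ borel cs := hX ▸ Submonoid.subset_closure hf
      rcases act_simple_mul_eq_or_eq_e cs hf' hs' h with h1 | rfl
      · exact .inl h1
      · exact .inr hf
    | mul f g hf hg ihf ihg =>
      rw [hX] at hf hg
      obtain ⟨h1, h2⟩ := act_eq_of_act_mul_eq hf hg h
      rcases ihf h1 with h3 | h3
      · rcases ihg h2 with h4 | h4
        · exact .inl (by rw [act_mul, h3, h4])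
        · exact .inr h4
      · exact .inr h3
  -- Fixing `s w` would put it below `w`, against the lengths.
  refine (key (e cs w) (hX ▸ e_mem_borel cs w) (act_self_e cs w)).resolve_left fun h => ?_
  have h1 := ((act_e_eq_iff cs).mp h).length_le
  rw [cs.not_isLeftDescent_iff.mp hs] at h1
  omega

theorem one_mem_grassmannianIdempotents : 1 ∈ grassmannianIdempotents cs := by
  refine ⟨longest cs, ?_, (e_longest cs).symm⟩
  rw [mul_inv_cancel]
  intro i hi
  exact absurd hi (cs.not_isRightDescent_one i)

theorem generates_grassmannianIdempotents :
    Generates (borel cs) (grassmannianIdempotents cs) := by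
  have h := generatesAsMonoid_grassmannianIdempotents cs
  apply le_antisymm
  · rw [Subsemigroup.closure_le]
    intro f hf
    change f ∈ borel cs
    rw [← h]
    exact Submonoid.subset_closure hf
  · intro f hf
    change f ∈ borel cs at hf
    rw [← h] at hf
    induction hf using Submonoid.closure_induction with
    | one => exact Subsemigroup.subset_closure (one_mem_grassmannianIdempotents cs)
    | mem f hf => exact Subsemigroup.subset_closure hf
    | mul f g _ _ hf hg => exact mul_mem hf hg

theorem generatesAsMonoid_grassmannianIdempotents_diff_one :
    GeneratesAsMonoid (borel cs) (grassmannianIdempotents cs \ {1}) := by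
  rw [GeneratesAsMonoid, Submonoid.closure_sdiff_singleton_one]
  exact generatesAsMonoid_grassmannianIdempotents cs

theorem minimal_generates_iff (X : Set (RightEnd W)) :
    Minimal (Generates (borel cs)) X ↔ X = grassmannianIdempotents cs := by
  have hle : ∀ Y, Generates (borel cs) Y → grassmannianIdempotents cs ⊆ Y := by
    rintro Y hY _ ⟨w, hw, rfl⟩
    by_cases h : e cs w = 1
    · rw [h]
      exact hY.one_mem
    · exact e_mem_of_generatesAsMonoid hY.generatesAsMonoid hw h
  constructor
  · intro h
    exact (h.eq_of_subset (generates_grassmannianIdempotents cs) (hle X h.prop)).symm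
  · rintro rfl
    exact ⟨generates_grassmannianIdempotents cs, fun Y hY _ => hle Y hY⟩

theorem minimal_generatesAsMonoid_iff (X : Set (RightEnd W)) :
    Minimal (GeneratesAsMonoid (borel cs)) X ↔ X = grassmannianIdempotents cs \ {1} := by
  have hle : ∀ Y, GeneratesAsMonoid (borel cs) Y → grassmannianIdempotents cs \ {1} ⊆ Y := by
    rintro Y hY _ ⟨⟨w, hw, rfl⟩, h⟩
    exact e_mem_of_generatesAsMonoid hY hw h
  constructor
  · intro h
    exact (h.eq_of_subset (generatesAsMonoid_grassmannianIdempotents_diff_one cs) (hle X h.prop)).symm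
  · rintro rfl
    exact ⟨generatesAsMonoid_grassmannianIdempotents_diff_one cs, fun Y hY _ => hle Y hY⟩

theorem ncard_grassmannianIdempotents :
    (grassmannianIdempotents cs).ncard = {w : W | IsGrassmannian cs w}.ncard := by
  symm
  refine Set.ncard_congr (fun w _ => e cs (w⁻¹ * longest cs)) ?_ ?_ ?_
  · intro w hw
    refine ⟨_, ?_, rfl⟩
    rwa [mul_inv_rev, inv_inv, longest_inv, longest_mul_longest_mul]
  · intro u w _ _ h
    exact inv_injective (mul_right_cancel (e_injective cs h))
  · rintro _ ⟨w, hw, rfl⟩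
    refine ⟨longest cs * w⁻¹, hw, ?_⟩
    rw [mul_inv_rev, inv_inv, longest_inv, mul_assoc, longest_mul_longest, mul_one]

end Generators

/-! ### Counting permutations with at most one descent. -/

section Permutations

variable {n : ℕ}

/-- The positions of the descents of a permutation in one-line notation. -/
def permDescents (σ : Equiv.Perm (Fin (n + 1))) : Set (Fin n) := {i | σ i.succ < σ i.castSucc}

theorem decide_le_decide_of_imp {p q : Prop} [Decidable p] [Decidable q] (h : p → q) :
    decide p ≤ decide q := by
  rw [Bool.le_iff_imp, decide_eq_true_iff, decide_eq_true_iff]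
  exact h

theorem comp_sort_of_mem_permDescents {f : Fin (n + 1) → Bool} {i : Fin n}
    (hi : i ∈ permDescents (Tuple.sort f)) :
    f (Tuple.sort f i.castSucc) = false ∧ f (Tuple.sort f i.succ) = true := by
  obtain ⟨h1, h2⟩ := Tuple.eq_sort_iff.mp (rfl : Tuple.sort f = Tuple.sort f)
  have h3 : f (Tuple.sort f i.castSucc) ≤ f (Tuple.sort f i.succ) := h1 i.castSucc_lt_succ.le
  have h4 : f (Tuple.sort f i.castSucc) ≠ f (Tuple.sort f i.succ) := fun h =>
    lt_asymm hi (h2 _ _ i.castSucc_lt_succ h)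
  revert h3 h4
  generalize f (Tuple.sort f i.castSucc) = a
  generalize f (Tuple.sort f i.succ) = b
  revert a b
  decide

theorem permDescents_sort_subsingleton (f : Fin (n + 1) → Bool) :
    (permDescents (Tuple.sort f)).Subsingleton := by
  have key : ∀ i j, i ∈ permDescents (Tuple.sort f) → j ∈ permDescents (Tuple.sort f) →
      ¬ i < j := by
    intro i j hi hj hij
    have h1 := (comp_sort_of_mem_permDescents hi).2
    have h2 := (comp_sort_of_mem_permDescents hj).1
    have h3 : f (Tuple.sort f i.succ) ≤ f (Tuple.sort f j.castSucc) :=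
      Tuple.monotone_sort f (Fin.succ_le_castSucc_iff.mpr hij)
    rw [h1, h2] at h3
    exact absurd h3 (by decide)
  intro i hi j hj
  exact le_antisymm (not_lt.mp (key j i hj hi)) (not_lt.mp (key i j hi hj))

/-- The descent marks where the sorted word jumps from `false` to `true`. Hence the sorting
permutation determines a non-monotone `f`. -/
theorem comp_sort_eq_of_mem_permDescents {f : Fin (n + 1) → Bool} {i : Fin n}
    (hi : i ∈ permDescents (Tuple.sort f)) (x : Fin (n + 1)) :
    f (Tuple.sort f x) = decide (i.succ ≤ x) := by
  obtain ⟨h1, h2⟩ := comp_sort_of_mem_permDescents hi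
  have hm := Tuple.monotone_sort f
  by_cases hx : i.succ ≤ x
  · have h3 : f (Tuple.sort f i.succ) ≤ f (Tuple.sort f x) := hm hx
    rw [h2] at h3
    rw [decide_eq_true hx]
    exact top_le_iff.mp h3
  · have h3 : f (Tuple.sort f x) ≤ f (Tuple.sort f i.castSucc) :=
      hm (Fin.le_castSucc_iff.mpr (not_le.mp hx))
    rw [h1] at h3
    rw [decide_eq_false hx]
    exact le_bot_iff.mp h3

theorem permDescents_nonempty {σ : Equiv.Perm (Fin (n + 1))} (h : σ ≠ 1) :
    (permDescents σ).Nonempty := by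
  by_contra hne
  rw [Set.not_nonempty_iff_eq_empty] at hne
  apply h
  have hs : StrictMono σ := Fin.strictMono_iff_lt_succ.mpr fun i => by
    have : i ∉ permDescents σ := by simp [hne]
    exact lt_of_le_of_ne (not_lt.mp this) (σ.injective.ne i.castSucc_lt_succ.ne)
  exact (Equiv.Perm.monotone_iff σ).mp hs.monotone

theorem exists_sort_eq {σ : Equiv.Perm (Fin (n + 1))} (hσ : (permDescents σ).Subsingleton)
    (h : σ ≠ 1) : ∃ f : Fin (n + 1) → Bool, Tuple.sort f = σ := by
  obtain ⟨k, hk⟩ := permDescents_nonempty h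
  refine ⟨fun x => decide (k.succ ≤ σ.symm x), (Tuple.eq_sort_iff.mpr ⟨?_, ?_⟩).symm⟩
  · intro x y hxy
    simp only [Function.comp_apply, Equiv.symm_apply_apply]
    exact decide_le_decide_of_imp fun hx => hx.trans hxy
  -- Adding `n + 1`, which exceeds every value of `σ`, past the position `k` removes the only
  -- descent; on either side of `k` the permutation `σ` is therefore increasing.
  · have hs : StrictMono fun x => (σ x : ℕ) + if k.succ ≤ x then n + 1 else 0 := by
      refine Fin.strictMono_iff_lt_succ.mpr fun i => ?_
      rcases eq_or_ne i k with rfl | hik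
      · have h1 : ¬ i.succ ≤ i.castSucc := not_le.mpr i.castSucc_lt_succ
        have h2 := (σ i.castSucc).is_lt
        simp only [h1, le_refl, if_true, if_false]
        omega
      · have h1 : i ∉ permDescents σ := fun hi => hik (hσ hi hk)
        have h2 : σ i.castSucc < σ i.succ :=
          lt_of_le_of_ne (not_lt.mp h1) (σ.injective.ne i.castSucc_lt_succ.ne)
        have h3 : (σ i.castSucc : ℕ) < σ i.succ := h2
        have h4 : k.succ ≤ i.castSucc ↔ k.succ ≤ i.succ := by
          rw [Fin.le_def, Fin.le_def]
          have : (i : ℕ) ≠ k := fun h => hik (Fin.ext h)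
          simp only [Fin.val_succ, Fin.val_castSucc]
          omega
        simp only [h4]
        omega
    intro i j hij hf
    simp only [Equiv.symm_apply_apply, decide_eq_decide] at hf
    have := hs hij
    simp only [hf] at this
    exact Fin.lt_def.mpr (by omega)

theorem ncard_monotone_bool (N : ℕ) : {f : Fin N → Bool | Monotone f}.ncard = N + 1 := by
  have h : {f : Fin N → Bool | Monotone f} =
      (fun k (x : Fin N) => decide (k ≤ (x : ℕ))) '' (Finset.range (N + 1) : Set ℕ) := by
    ext f
    simp only [Set.mem_ofPred_eq, Set.mem_image, Finset.coe_range, Set.mem_Iio]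
    constructor
    · intro hf
      refine ⟨(Finset.univ.filter fun i => f i ≤ false).card, ?_, funext fun x => ?_⟩
      · have := Finset.card_filter_le Finset.univ fun i => f i ≤ false
        rw [Finset.card_univ, Fintype.card_fin] at this
        omega
      · have := Tuple.lt_card_le_iff_apply_le_of_monotone hf (a := false) (j := x)
        cases hx : f x
        · simpa [hx] using this
        · simpa [hx, show ¬ true ≤ false by decide] using this
    · rintro ⟨k, -, rfl⟩ x y hxy
      exact decide_le_decide_of_imp fun hx => hx.trans hxy
  rw [h, Set.InjOn.ncard_image, Set.ncard_coe_finset, Finset.card_range]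
  intro k hk l hl hkl
  simp only [Finset.coe_range, Set.mem_Iio] at hk hl
  by_contra hne
  rcases lt_or_gt_of_ne hne with h | h
  · have := congrFun hkl ⟨k, by omega⟩
    simp only [decide_eq_decide] at this
    omega
  · have := congrFun hkl ⟨l, by omega⟩
    simp only [decide_eq_decide] at this
    omega

/-- Of the `2 ^ (n + 1)` binary words, the `n + 2` monotone ones sort by the identity and the others
by distinct nontrivial permutations. The identity itself is then added once. -/
theorem ncard_permDescents_subsingleton (n : ℕ) :
    {σ : Equiv.Perm (Fin (n + 1)) | (permDescents σ).Subsingleton}.ncard =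
      2 ^ (n + 1) - (n + 1) := by
  have hone : permDescents (1 : Equiv.Perm (Fin (n + 1))) = ∅ := by
    ext i
    simpa [permDescents] using i.castSucc_lt_succ.le
  have h : {σ : Equiv.Perm (Fin (n + 1)) | (permDescents σ).Subsingleton} =
      insert 1 (Tuple.sort '' {f : Fin (n + 1) → Bool | ¬ Monotone f}) := by
    ext σ
    simp only [Set.mem_ofPred_eq, Set.mem_insert_iff, Set.mem_image]
    constructor
    · intro hσ
      by_cases h1 : σ = 1
      · exact .inl h1
      · obtain ⟨f, rfl⟩ := exists_sort_eq hσ h1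
        exact .inr ⟨f, fun hf => h1 (Tuple.sort_eq_refl_iff_monotone.mpr hf), rfl⟩
    · rintro (rfl | ⟨f, -, rfl⟩)
      · rw [hone]
        exact Set.subsingleton_empty
      · exact permDescents_sort_subsingleton f
  have hinj : Set.InjOn (Tuple.sort : (Fin (n + 1) → Bool) → _)
      {f : Fin (n + 1) → Bool | ¬ Monotone f} := by
    intro f hf g hg hfg
    have h1 : Tuple.sort f ≠ 1 := fun h => hf (Tuple.sort_eq_refl_iff_monotone.mp h)
    obtain ⟨i, hi⟩ := permDescents_nonempty h1
    funext x
    have hf' := comp_sort_eq_of_mem_permDescents hi ((Tuple.sort f).symm x)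
    rw [Equiv.apply_symm_apply] at hf'
    rw [hf']
    rw [hfg] at hi ⊢
    have hg' := comp_sort_eq_of_mem_permDescents hi ((Tuple.sort g).symm x)
    rw [Equiv.apply_symm_apply] at hg'
    exact hg'.symm
  have hcompl : {f : Fin (n + 1) → Bool | ¬ Monotone f} = {f | Monotone f}ᶜ := rfl
  have hcard := Set.ncard_add_ncard_compl {f : Fin (n + 1) → Bool | Monotone f}
  rw [ncard_monotone_bool, Nat.card_eq_fintype_card, Fintype.card_fun, Fintype.card_fin,
    Fintype.card_bool] at hcard
  rw [h, Set.ncard_insert_of_notMem, hinj.ncard_image, hcompl]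
  · omega
  · rintro ⟨f, hf, hf1⟩
    exact hf (Tuple.sort_eq_refl_iff_monotone.mp hf1)

/-- The elementary transposition of two adjacent letters. -/
def adjSwap (i : Fin n) : Equiv.Perm (Fin (n + 1)) := Equiv.swap i.castSucc i.succ

theorem adjSwap_val (i : Fin n) (x : Fin (n + 1)) :
    (adjSwap i x : ℕ) =
      if (x : ℕ) = i then (i : ℕ) + 1 else if (x : ℕ) = i + 1 then (i : ℕ) else x := by
  rw [adjSwap, Equiv.swap_apply_def]
  simp only [Fin.ext_iff, Fin.val_castSucc, Fin.val_succ]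
  split_ifs <;> simp

theorem adjSwap_mul_self (i : Fin n) : adjSwap i * adjSwap i = 1 := Equiv.swap_mul_self _ _

theorem adjSwap_mul_comm {i j : Fin n} (hij : i ≠ j) (h1 : (j : ℕ) + 1 ≠ i)
    (h2 : (i : ℕ) + 1 ≠ j) : adjSwap i * adjSwap j = adjSwap j * adjSwap i := by
  have h3 : (i : ℕ) ≠ j := fun h => hij (Fin.ext h)
  ext x
  simp only [Equiv.Perm.mul_apply, adjSwap_val]
  split_ifs <;> omega

theorem adjSwap_pow_three {i j : Fin n} (h : (i : ℕ) + 1 = j) :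
    (adjSwap i * adjSwap j) ^ 3 = 1 := by
  have h1 : i.succ = j.castSucc := Fin.ext (by simp [h])
  have h2 : i.castSucc ≠ j.succ := fun h' => by
    have := congrArg Fin.val h'
    simp at this
    omega
  have h3 := Equiv.Perm.isThreeCycle_swap_mul_swap_same (a := i.succ) (b := i.castSucc)
    (c := j.succ) i.castSucc_lt_succ.ne' (by rw [h1]; exact j.castSucc_lt_succ.ne) h2
  rw [adjSwap, adjSwap, Equiv.swap_comm, ← h1, ← h3.orderOf, pow_orderOf_eq_one]

theorem adjSwap_isLiftable : (CoxeterMatrix.A n).IsLiftable adjSwap := by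
  intro i j
  change (adjSwap i * adjSwap j) ^ (if i = j then 1 else
    if (j : ℕ) + 1 = i ∨ (i : ℕ) + 1 = j then 3 else 2) = 1
  split_ifs with hij h
  · rw [hij, adjSwap_mul_self, pow_one]
  · rcases h with h | h
    · rw [← inv_inj, inv_one, ← inv_pow, mul_inv_rev]
      exact adjSwap_pow_three h
    · exact adjSwap_pow_three h
  · push Not at h
    rw [pow_two, mul_assoc, ← mul_assoc (adjSwap j), ← adjSwap_mul_comm hij h.1 h.2, mul_assoc,
      adjSwap_mul_self, mul_one, adjSwap_mul_self]

end Permutations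

/-! ### Coxeter groups of type `A` as symmetric groups. -/

section TypeA

variable {B W : Type*} [Group W] {M : CoxeterMatrix B} (cs : CoxeterSystem M W) {n : ℕ}
  {r : B ≃ Fin n}

theorem adjSwap_comp_isLiftable (hM : M.reindex r = CoxeterMatrix.A n) :
    M.IsLiftable fun i => adjSwap (r i) := by
  intro i j
  have h := adjSwap_isLiftable (r i) (r j)
  rw [← hM, M.reindex_apply, Equiv.symm_apply_apply, Equiv.symm_apply_apply] at h
  exact h

/-- The homomorphism from a Coxeter group of type `A` to the symmetric group. -/
noncomputable def toPerm (hM : M.reindex r = CoxeterMatrix.A n) : W →* Equiv.Perm (Fin (n + 1)) :=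
  cs.lift ⟨fun i => adjSwap (r i), adjSwap_comp_isLiftable hM⟩

theorem toPerm_simple (hM : M.reindex r = CoxeterMatrix.A n) (i : B) : toPerm cs hM (cs.simple i) = adjSwap (r i) :=
  cs.lift_apply_simple _ i

theorem toPerm_mul_simple_apply (hM : M.reindex r = CoxeterMatrix.A n) (w : W) (i : B) (x : Fin (n + 1)) :
    toPerm cs hM (w * cs.simple i) x = toPerm cs hM w (adjSwap (r i) x) := by
  rw [map_mul, toPerm_simple, Equiv.Perm.mul_apply]

theorem simple_mul_simple_comm (hM : M.reindex r = CoxeterMatrix.A n) {i j : B} (hij : i ≠ j) (h1 : (r j : ℕ) + 1 ≠ r i)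
    (h2 : (r i : ℕ) + 1 ≠ r j) : cs.simple i * cs.simple j = cs.simple j * cs.simple i := by
  have h3 : M i j = 2 := by
    have : M i j = M.reindex r (r i) (r j) := by
      rw [M.reindex_apply, Equiv.symm_apply_apply, Equiv.symm_apply_apply]
    rw [this, hM]
    change (if r i = r j then 1 else
      if (r j : ℕ) + 1 = r i ∨ (r i : ℕ) + 1 = r j then 3 else 2) = 2
    rw [if_neg (r.injective.ne hij), if_neg (by tauto)]
  have h4 := cs.simple_mul_simple_pow i j
  rw [h3, pow_two] at h4
  rw [mul_eq_one_iff_eq_inv.mp h4]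
  simp

/-- Induction on length after removing a right descent `j`, by a case analysis in the rank two
subgroup of `s_i` and `s_j`. Bijectivity of `toPerm` follows from the resulting match of descents.
-/
theorem toPerm_lt_of_not_isRightDescent (hM : M.reindex r = CoxeterMatrix.A n) (w : W) (i : B) (hi : ¬ cs.IsRightDescent w i) :
    toPerm cs hM w (r i).castSucc < toPerm cs hM w (r i).succ := by
  induction hn : cs.length w using Nat.strong_induction_on generalizing w i with
  | _ m ih =>
    by_cases hw : w = 1
    · rw [hw, map_one]
      exact (r i).castSucc_lt_succ
    obtain ⟨j, hj⟩ := cs.exists_rightDescent_of_ne_one hw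
    have hij : i ≠ j := by
      rintro rfl
      exact hi hj
    have hijv : (r i : ℕ) ≠ r j := fun h => hij (r.injective (Fin.ext h))
    obtain ⟨u, rfl⟩ : ∃ u, w = u * cs.simple j := ⟨w * cs.simple j, by simp⟩
    have hwi := cs.not_isRightDescent_iff.mp hi
    have hju := cs.isRightDescent_iff_not_isRightDescent_mul.mp hj
    rw [cs.simple_mul_simple_cancel_right] at hju
    have hul := cs.not_isRightDescent_iff.mp hju
    by_cases hadj : (r j : ℕ) + 1 ≠ r i ∧ (r i : ℕ) + 1 ≠ r j
    · have hiu : ¬ cs.IsRightDescent u i := by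
        intro h
        rw [cs.isRightDescent_iff] at h
        rw [mul_assoc, ← simple_mul_simple_comm cs hM hij hadj.1 hadj.2, ← mul_assoc] at hwi
        have := cs.length_mul_simple (u * cs.simple i) j
        omega
      have h1 := ih _ (by omega) u i hiu rfl
      have h2 : adjSwap (r j) (r i).castSucc = (r i).castSucc := by
        apply Fin.ext
        rw [adjSwap_val, Fin.val_castSucc, if_neg hijv, if_neg hadj.1.symm]
      have h3 : adjSwap (r j) (r i).succ = (r i).succ := by
        apply Fin.ext
        rw [adjSwap_val, Fin.val_succ, if_neg hadj.2, if_neg (by omega)]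
      rwa [toPerm_mul_simple_apply, toPerm_mul_simple_apply, h2, h3]
    have hadj' : (r i : ℕ) + 1 = r j ∨ (r j : ℕ) + 1 = r i := by tauto
    -- Here `w = v s_i s_j`, and the braid relation shows that `j` is not a descent of `v`. The
    -- values of `w` at the positions of `i` are those of `v` at the positions of `j`.
    by_cases hiu : cs.IsRightDescent u i
    · obtain ⟨v, rfl⟩ : ∃ v, u = v * cs.simple i := ⟨u * cs.simple i, by simp⟩
      have hiv := cs.isRightDescent_iff_not_isRightDescent_mul.mp hiu
      rw [cs.simple_mul_simple_cancel_right] at hiv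
      have hvl := cs.not_isRightDescent_iff.mp hiv
      have hjv : ¬ cs.IsRightDescent v j := by
        intro h
        rw [cs.isRightDescent_iff] at h
        have h1 : v * cs.simple i * cs.simple j * cs.simple i =
            v * cs.simple j * cs.simple i * cs.simple j := by
          have h2 : M i j = 3 := by
            have : M i j = M.reindex r (r i) (r j) := by
              rw [M.reindex_apply, Equiv.symm_apply_apply, Equiv.symm_apply_apply]
            rw [this, hM]
            change (if r i = r j then 1 else
              if (r j : ℕ) + 1 = r i ∨ (r i : ℕ) + 1 = r j then 3 else 2) = 3
            rw [if_neg (r.injective.ne hij), if_pos (by tauto)]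
          have h3 := cs.simple_mul_simple_pow i j
          rw [h2, pow_succ, pow_two] at h3
          have h4 : (cs.simple i * cs.simple j * cs.simple i) *
              (cs.simple j * cs.simple i * cs.simple j) = 1 := by
            rw [← h3]
            simp only [mul_assoc]
          have h5 := mul_eq_one_iff_eq_inv.mp h4
          simp only [mul_inv_rev, cs.inv_simple] at h5
          simp only [mul_assoc] at h5 ⊢
          rw [h5]
        rw [h1] at hwi
        have h2 := cs.length_mul_simple (v * cs.simple j) i
        have h3 := cs.length_mul_simple (v * cs.simple j * cs.simple i) j
        omega
      have h1 := ih _ (by omega) v i hiv rfl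
      have h2 := ih _ (by omega) v j hjv rfl
      simp only [toPerm_mul_simple_apply]
      rcases hadj' with h | h
      · have h3 : adjSwap (r i) (adjSwap (r j) (r i).castSucc) = (r j).castSucc := by
          apply Fin.ext
          simp only [adjSwap_val, Fin.val_castSucc]
          split_ifs <;> omega
        have h4 : adjSwap (r i) (adjSwap (r j) (r i).succ) = (r j).succ := by
          apply Fin.ext
          simp only [adjSwap_val, Fin.val_succ]
          split_ifs <;> omega
        rwa [h3, h4]
      · have h3 : adjSwap (r i) (adjSwap (r j) (r i).castSucc) = (r j).castSucc := by
          apply Fin.ext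
          simp only [adjSwap_val, Fin.val_castSucc]
          split_ifs <;> omega
        have h4 : adjSwap (r i) (adjSwap (r j) (r i).succ) = (r j).succ := by
          apply Fin.ext
          simp only [adjSwap_val, Fin.val_succ]
          split_ifs <;> omega
        rwa [h3, h4]
    -- Neither `i` nor `j` is a descent of `u`, so `u` increases on three consecutive positions and
    -- the claim compares the outer two.
    · have h1 := ih _ (by omega) u i hiu rfl
      have h2 := ih _ (by omega) u j hju rfl
      rw [toPerm_mul_simple_apply, toPerm_mul_simple_apply]
      rcases hadj' with h | h
      · have h3 : adjSwap (r j) (r i).castSucc = (r i).castSucc := by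
          apply Fin.ext
          simp only [adjSwap_val, Fin.val_castSucc]
          split_ifs <;> omega
        have h4 : adjSwap (r j) (r i).succ = (r j).succ := by
          apply Fin.ext
          simp only [adjSwap_val, Fin.val_succ]
          split_ifs; omega
        have h5 : (r j).castSucc = (r i).succ := Fin.ext (by simp [h])
        rw [h3, h4]
        rw [h5] at h2
        exact h1.trans h2
      · have h3 : adjSwap (r j) (r i).castSucc = (r j).castSucc := by
          apply Fin.ext
          simp only [adjSwap_val, Fin.val_castSucc]
          split_ifs <;> omega
        have h4 : adjSwap (r j) (r i).succ = (r i).succ := by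
          apply Fin.ext
          simp only [adjSwap_val, Fin.val_succ]
          split_ifs <;> omega
        have h5 : (r j).succ = (r i).castSucc := Fin.ext (by simp [h])
        rw [h3, h4]
        rw [h5] at h2
        exact h2.trans h1

theorem isRightDescent_iff_mem_permDescents (hM : M.reindex r = CoxeterMatrix.A n) (w : W) (i : B) :
    cs.IsRightDescent w i ↔ r i ∈ permDescents (toPerm cs hM w) := by
  constructor
  · intro h
    obtain ⟨u, rfl⟩ : ∃ u, w = u * cs.simple i := ⟨w * cs.simple i, by simp⟩
    have h1 := cs.isRightDescent_iff_not_isRightDescent_mul.mp h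
    rw [cs.simple_mul_simple_cancel_right] at h1
    have h2 := toPerm_lt_of_not_isRightDescent cs hM u i h1
    change toPerm cs hM _ _ < toPerm cs hM _ _
    rw [toPerm_mul_simple_apply, toPerm_mul_simple_apply, adjSwap, Equiv.swap_apply_left,
      Equiv.swap_apply_right]
    exact h2
  · intro h
    by_contra h1
    exact lt_asymm h (toPerm_lt_of_not_isRightDescent cs hM w i h1)

theorem toPerm_bijective (hM : M.reindex r = CoxeterMatrix.A n) : Function.Bijective (toPerm cs hM) := by
  constructor
  · rw [injective_iff_map_eq_one]
    intro w hw
    by_contra hne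
    obtain ⟨i, hi⟩ := cs.exists_rightDescent_of_ne_one hne
    rw [isRightDescent_iff_mem_permDescents cs hM, hw] at hi
    exact lt_asymm hi (r i).castSucc_lt_succ
  · rw [← MonoidHom.mrange_eq_top, eq_top_iff, ← Equiv.Perm.mclosure_swap_castSucc_succ n,
      Submonoid.closure_le]
    rintro _ ⟨i, rfl⟩
    exact ⟨cs.simple (r.symm i), by rw [toPerm_simple, Equiv.apply_symm_apply]; rfl⟩

theorem ncard_isGrassmannian (hM : M.reindex r = CoxeterMatrix.A n) :
    {w : W | IsGrassmannian cs w}.ncard = 2 ^ (n + 1) - (n + 1) := by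
  have h : ∀ w, IsGrassmannian cs w ↔ (permDescents (toPerm cs hM w)).Subsingleton := by
    intro w
    have : {i | cs.IsRightDescent w i} = r ⁻¹' permDescents (toPerm cs hM w) :=
      Set.ext fun i => isRightDescent_iff_mem_permDescents cs hM w i
    rw [IsGrassmannian, this]
    constructor
    · intro h i hi j hj
      apply r.symm.injective
      exact h (by simpa) (by simpa)
    · intro h
      exact h.preimage r.injective
  rw [← ncard_permDescents_subsingleton]
  refine Set.ncard_congr (fun w _ => toPerm cs hM w) (fun w hw => (h w).mp hw)
    (fun u w _ _ huw => (toPerm_bijective cs hM).1 huw) ?_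
  intro σ hσ
  obtain ⟨w, rfl⟩ := (toPerm_bijective cs hM).2 σ
  exact ⟨w, (h w).mpr hσ, rfl⟩

end TypeA

end BiHecke

theorem mainTheorem6 {B W : Type*} [Group W] [Finite W] {M : CoxeterMatrix B}
    (cs : CoxeterSystem M W) :
    -- the `e_w` are idempotents of the Borel submonoid
    (∀ w : W, BiHecke.e cs w ∈ BiHecke.borel cs ∧ IsIdempotentElem (BiHecke.e cs w)) ∧
    -- the unique minimal generating set
    (∀ X : Set (BiHecke.RightEnd W),
      Minimal (BiHecke.Generates (BiHecke.borel cs)) X ↔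
        X = BiHecke.grassmannianIdempotents cs) ∧
    -- if the identity is given for free, the unique minimal generating set loses the identity only
    BiHecke.e cs (BiHecke.longest cs) = 1 ∧
    1 ∈ BiHecke.grassmannianIdempotents cs ∧
    (∀ X : Set (BiHecke.RightEnd W),
      Minimal (BiHecke.GeneratesAsMonoid (BiHecke.borel cs)) X ↔
        X = BiHecke.grassmannianIdempotents cs \ {1}) ∧
    -- its size in type `A_n`, the symmetric group on `n + 1` letters
    (∀ (n : ℕ) (r : B ≃ Fin n), M.reindex r = CoxeterMatrix.A n →
      (BiHecke.grassmannianIdempotents cs).ncard = 2 ^ (n + 1) - (n + 1)) :=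
  ⟨fun w => ⟨BiHecke.e_mem_borel cs w, BiHecke.isIdempotentElem_e cs w⟩,
    BiHecke.minimal_generates_iff cs, BiHecke.e_longest cs,
    BiHecke.one_mem_grassmannianIdempotents cs, BiHecke.minimal_generatesAsMonoid_iff cs,
    fun _ _ hM => by
      rw [BiHecke.ncard_grassmannianIdempotents, BiHecke.ncard_isGrassmannian cs hM]⟩
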